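/- Let $\mathbf{RCA}_0$ be the usual subsystem of second-order arithmetic, consisting of the basic axioms of arithmetic, $\Sigma^0_1$-induction and $\Delta^0_1$-comprehension (the latter two with arbitrary number and set parameters). Let $(\mathcal{WF}2)$ be the statement that for any infinite sequence of (countable) well orders $L_0,L_1,\ldots$ there are indices $i\neq j$ such that $L_i$ embeds into $L_j$. Then $\mathbf{RCA}_0$ proves that $(\mathcal{WF}2)$ implies the principle of $\Sigma^0_2$-induction, i.e. every structure $(M,S)$ for the language of second-order arithmetic (number domain $M$ with $0,1,+,\cdot,<$, set variables ranging over $S\subseteq\mathcal P(M)$) that satisfies $\mathbf{RCA}_0$ and $(\mathcal{WF}2)$ also satisfies, for every $\Sigma^0_2$-formula $\psi$ with number and set parameters, $$\psi(0)\wedge\forall x\,(\psi(x)\to\psi(x+1))\to\forall x\,\psi(x).$$ Here, as usual in $\mathbf{RCA}_0$, a countable linear order is coded by its set of pairs $\{(a,b):a\leq_L b\}$ of numbers, and it is a well order if there is no infinite sequence $f:\mathbb N\to L$ with $f(n+1)<_L f(n)$ for all $n$; an embedding is a strictly order-preserving map; an infinite sequence of orders is coded by a single set $Z$ with $L_i=\{m:(m,i)\in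 Z\}$. All these objects are elements of $S$ when the notions are interpreted in $(M,S)$, and $\mathbb N$ is interpreted by $M$. -/

import Mathlib

/-!
Second-order arithmetic and the base theory `RCA₀`, in the usual semantics.

A structure for the two-sorted language `L₂` of second-order arithmetic consists of a number
domain `M` with `0, 1, +, ·, <` and of a family `S : Set (Set M)`, the range of the set variables.
Neither is assumed to be standard: `M` may be a nonstandard model, and the set quantifiers range
over `S` only. A statement is a theorem of `RCA₀` if it holds in all such structures that satisfy
the axioms of `RCA₀`.
-/

namespace SecondOrderArithmetic

/-- Number terms of `L₂` in the number variables `0, …, n - 1`. -/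
inductive NumTerm (n : ℕ) : Type
  | var (i : Fin n) : NumTerm n
  | zero : NumTerm n
  | one : NumTerm n
  | add (s t : NumTerm n) : NumTerm n
  | mul (s t : NumTerm n) : NumTerm n

/-- Bounded quantifier formulas (`Σ⁰₀` formulas) of `L₂` in the set variables `0, …, k - 1` and
the number variables `0, …, n - 1`. In `ball t φ`, i.e. `∀ a < t, φ`, the bound variable is the
variable `0` of `φ`, and it does not occur in `t`. The connectives and quantifiers that are not
listed are defined by negation. -/
inductive BddFormula (k : ℕ) : ℕ → Type
  | eq {n : ℕ} (s t : NumTerm n) : BddFormula k n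
  | lt {n : ℕ} (s t : NumTerm n) : BddFormula k n
  | mem {n : ℕ} (t : NumTerm n) (i : Fin k) : BddFormula k n
  | neg {n : ℕ} (φ : BddFormula k n) : BddFormula k n
  | and {n : ℕ} (φ ψ : BddFormula k n) : BddFormula k n
  | ball {n : ℕ} (t : NumTerm n) (φ : BddFormula k (n + 1)) : BddFormula k n

section Semantics

variable {M : Type*} [Zero M] [One M] [Add M] [Mul M] [LT M]

/-- The value of a term under an assignment. -/
def NumTerm.eval {n : ℕ} (v : Fin n → M) : NumTerm n → M
  | .var i => v i
  | .zero => 0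
  | .one => 1
  | .add s t => s.eval v + t.eval v
  | .mul s t => s.eval v * t.eval v

/-- Satisfaction of a bounded quantifier formula under an assignment `X` of sets and an
assignment `v` of numbers. -/
def BddFormula.Sat {k : ℕ} (X : Fin k → Set M) : {n : ℕ} → BddFormula k n → (Fin n → M) → Prop
  | _, .eq s t, v => s.eval v = t.eval v
  | _, .lt s t, v => s.eval v < t.eval v
  | _, .mem t i, v => t.eval v ∈ X i
  | _, .neg φ, v => ¬ φ.Sat X v
  | _, .and φ ψ, v => φ.Sat X v ∧ ψ.Sat X v
  | _, .ball t φ, v => ∀ a : M, a < t.eval v → φ.Sat X (Fin.cons a v)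

/-- `P` is given by a formula `φ(x) = ∃ u, θ(u, x)` with `θ` bounded, with number parameters from
`M` and set parameters from `S`. -/
def IsSigma01 (S : Set (Set M)) (P : M → Prop) : Prop :=
  ∃ (k n : ℕ) (θ : BddFormula k (n + 2)) (X : Fin k → Set M) (p : Fin n → M),
    (∀ i, X i ∈ S) ∧ ∀ x, P x ↔ ∃ u : M, θ.Sat X (Fin.cons u (Fin.cons x p))

/-- `P` is given by a formula `φ(x) = ∀ u, θ(u, x)` with `θ` bounded, with parameters. -/
def IsPi01 (S : Set (Set M)) (P : M → Prop) : Prop :=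
  ∃ (k n : ℕ) (θ : BddFormula k (n + 2)) (X : Fin k → Set M) (p : Fin n → M),
    (∀ i, X i ∈ S) ∧ ∀ x, P x ↔ ∀ u : M, θ.Sat X (Fin.cons u (Fin.cons x p))

/-- `P` is given by a formula `φ(x) = ∃ u, ∀ v, θ(v, u, x)` with `θ` bounded, with parameters. -/
def IsSigma02 (S : Set (Set M)) (P : M → Prop) : Prop :=
  ∃ (k n : ℕ) (θ : BddFormula k (n + 3)) (X : Fin k → Set M) (p : Fin n → M),
    (∀ i, X i ∈ S) ∧
      ∀ x, P x ↔ ∃ u : M, ∀ v : M, θ.Sat X (Fin.cons v (Fin.cons u (Fin.cons x p)))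

/-- The universal closure of the induction axiom for `P`, for all `P` in a class `Γ`. -/
def InductionFor (Γ : (M → Prop) → Prop) : Prop :=
  ∀ P : M → Prop, Γ P → P 0 → (∀ x, P x → P (x + 1)) → ∀ x, P x

/-- `(M, S)` satisfies the scheme of `Σ⁰₂`-induction. -/
def Sigma02Induction (S : Set (Set M)) : Prop :=
  InductionFor (IsSigma02 S)

/-- `(M, S)` is a model of `RCA₀`: the basic axioms of arithmetic, `Σ⁰₁`-induction, and
`Δ⁰₁`-comprehension, the two schemes with arbitrary number and set parameters. -/
structure ModelsRCA0 (S : Set (Set M)) : Prop where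
  succ_ne_zero : ∀ m : M, m + 1 ≠ 0
  succ_inj : ∀ m n : M, m + 1 = n + 1 → m = n
  add_zero : ∀ m : M, m + 0 = m
  add_succ : ∀ m n : M, m + (n + 1) = (m + n) + 1
  mul_zero : ∀ m : M, m * 0 = 0
  mul_succ : ∀ m n : M, m * (n + 1) = m * n + m
  not_lt_zero : ∀ m : M, ¬ m < 0
  lt_succ_iff : ∀ m n : M, m < n + 1 ↔ m < n ∨ m = n
  sigma01_induction : InductionFor (IsSigma01 S)
  delta01_comprehension : ∀ P Q : M → Prop, IsSigma01 S P → IsPi01 S Q → (∀ x, P x ↔ Q x) →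
    ∃ A ∈ S, ∀ x, x ∈ A ↔ P x

/-- The usual code `(m + n)² + m` of the ordered pair of `m` and `n`. -/
def pair (m n : M) : M := (m + n) * (m + n) + m

/-- The `i`-th member `{m | (m, i) ∈ Z}` of the sequence of sets that is coded by `Z`. -/
def nth (Z : Set M) (i : M) : Set M := {m | pair m i ∈ Z}

/-- The set of pairs `F` is a function from `A` to `B`. -/
def IsFunction (F A B : Set M) : Prop :=
  (∀ p ∈ F, ∃ a ∈ A, ∃ b ∈ B, p = pair a b) ∧ ∀ a ∈ A, ∃! b, pair a b ∈ F

/-- An order is coded by its reflexive order relation, a set `L` of pairs; `le L a b` is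
`a ≤_L b`. -/
def le (L : Set M) (a b : M) : Prop := pair a b ∈ L

/-- `a <_L b`. -/
def lt (L : Set M) (a b : M) : Prop := le L a b ∧ a ≠ b

/-- The underlying set of the order that is coded by `L`. -/
def field (L : Set M) : Set M := {a | le L a a}

/-- `L` codes a (reflexive) linear order on a set of numbers, possibly finite or empty. -/
structure IsLinOrder (L : Set M) : Prop where
  refl : ∀ a b, le L a b → a ∈ field L ∧ b ∈ field L
  antisymm : ∀ a b, le L a b → le L b a → a = b
  trans : ∀ a b c, le L a b → le L b c → le L a c
  total : ∀ a ∈ field L, ∀ b ∈ field L, le L a b ∨ le L b a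

/-- `L` is a well order in the sense of `(M, S)`: a linear order for which `S` contains no
infinite descending sequence `f : ℕ → L`, where `ℕ` is the number domain `M`. -/
def IsWellOrder (S : Set (Set M)) (L : Set M) : Prop :=
  IsLinOrder L ∧
    ¬ ∃ F ∈ S, IsFunction F Set.univ (field L) ∧
      ∀ n a b : M, pair n a ∈ F → pair (n + 1) b ∈ F → lt L b a

/-- `S` contains an embedding, i.e. a strictly order preserving map, from `L` to `L'`. -/
def Embeds (S : Set (Set M)) (L L' : Set M) : Prop :=
  ∃ F ∈ S, IsFunction F (field L) (field L') ∧
    ∀ a a' b b' : M, pair a b ∈ F → pair a' b' ∈ F → lt L a a' → lt L' b b'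

/-- `(M, S)` satisfies `(WF2)`: every infinite sequence of well orders has two members
with different indices one of which embeds into the other. -/
def WF2 (S : Set (Set M)) : Prop :=
  ∀ Z ∈ S, (∀ i : M, IsWellOrder S (nth Z i)) →
    ∃ i j : M, i ≠ j ∧ Embeds S (nth Z i) (nth Z j)

end Semantics

end SecondOrderArithmetic

set_option linter.unusedSectionVars false

/-! Suppose `Σ⁰₂`-induction fails: `P x`, that is `∃ u, ∀ v, T v u x`, holds at `0` and passes to
successors, but fails at `b`. Let `E x r` say that some `y ≤ x` has no witness `u < r`. By bounded
collection this is `Σ⁰₁`. For fixed `x` these `r` form an initial segment `E_x` that grows with `x`.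
The `x` with `E_x` bounded form a cut below `b`, and along this cut the bounds are unbounded
(`isCutFamily_of_progressive`).

From `E` one obtains well orders `L_i`, none of which embeds into another. Each is a sum of `b + b`
columns, and each column is an initial segment of `M`. Write `r` for the maximum of `E_y`. In the
first half, column `y` has length `(y + 1)(r + 1) + min(r, i)`, which grows with `i`; in the second
half, column `b + y` has length `max(1, r + 1 - i)`, which shrinks. Where `E_y` is unbounded, both
columns are all of `M`.

Let `L_i` embed into `L_j`. If `i < j` (`not_columnMap_of_lt`), no column from `b - 1` on can move
up, since the last one cannot. Some column of the second half has become too short, so it moves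
down, and with it every column back to `b`. The first half is then squeezed into one column less,
which pushes column `0` below itself. If `j < i` (`not_columnMap_of_gt`), column `b - 1` cannot move
up (`le_pred`), hence no earlier one can. A column of the first half is too long for its place and
moves down, and again column `0` would have to move below itself.

The cut is not a set of the model, so induction along it is not available. Every step instead takes
the least or greatest element of a `Σ⁰₁` property of the given embedding. -/

namespace SecondOrderArithmetic

/-! ### Bounded definability with parameters, as a property of relations. -/

section Definability

variable {M : Type*} [Zero M] [One M] [Add M] [Mul M] [LT M]

/-- Functions of `n` numbers that are given by terms with number parameters. -/
inductive IsTerm : (n : ℕ) → ((Fin n → M) → M) → Prop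
  | const {n : ℕ} (c : M) : IsTerm n fun _ => c
  | var {n : ℕ} (i : Fin n) : IsTerm n fun v => v i
  | add {n : ℕ} {f g : (Fin n → M) → M} :
      IsTerm n f → IsTerm n g → IsTerm n fun v => f v + g v
  | mul {n : ℕ} {f g : (Fin n → M) → M} :
      IsTerm n f → IsTerm n g → IsTerm n fun v => f v * g v

/-- Relations of `n` numbers that are given by bounded formulas with parameters. -/
inductive IsBdd (S : Set (Set M)) : (n : ℕ) → ((Fin n → M) → Prop) → Prop
  | eq {n : ℕ} {f g : (Fin n → M) → M} : IsTerm n f → IsTerm n g → IsBdd S n fun v => f v = g v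
  | lt {n : ℕ} {f g : (Fin n → M) → M} : IsTerm n f → IsTerm n g → IsBdd S n fun v => f v < g v
  | mem {n : ℕ} {f : (Fin n → M) → M} {A : Set M} :
      A ∈ S → IsTerm n f → IsBdd S n fun v => f v ∈ A
  | not {n : ℕ} {P : (Fin n → M) → Prop} : IsBdd S n P → IsBdd S n fun v => ¬ P v
  | and {n : ℕ} {P Q : (Fin n → M) → Prop} :
      IsBdd S n P → IsBdd S n Q → IsBdd S n fun v => P v ∧ Q v
  | or {n : ℕ} {P Q : (Fin n → M) → Prop} :
      IsBdd S n P → IsBdd S n Q → IsBdd S n fun v => P v ∨ Q v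
  | ball {n : ℕ} {t : (Fin n → M) → M} {P : (Fin n → M) → M → Prop} :
      IsTerm n t → IsBdd S (n + 1) (fun w => P (Fin.tail w) (w 0)) →
      IsBdd S n fun v => ∀ a, a < t v → P v a
  | bex {n : ℕ} {t : (Fin n → M) → M} {P : (Fin n → M) → M → Prop} :
      IsTerm n t → IsBdd S (n + 1) (fun w => P (Fin.tail w) (w 0)) →
      IsBdd S n fun v => ∃ a, a < t v ∧ P v a

/-- Replacement of number variables. -/
def NumTerm.rename {n n' : ℕ} (f : Fin n → Fin n') : NumTerm n → NumTerm n'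
  | .var i => .var (f i)
  | .zero => .zero
  | .one => .one
  | .add s t => .add (s.rename f) (t.rename f)
  | .mul s t => .mul (s.rename f) (t.rename f)

/-- Replacement of number and set variables. -/
def BddFormula.rename {k k' : ℕ} (g : Fin k → Fin k') :
    {n n' : ℕ} → (Fin n → Fin n') → BddFormula k n → BddFormula k' n'
  | _, _, f, .eq s t => .eq (s.rename f) (t.rename f)
  | _, _, f, .lt s t => .lt (s.rename f) (t.rename f)
  | _, _, f, .mem t i => .mem (t.rename f) (g i)
  | _, _, f, .neg φ => .neg (φ.rename g f)
  | _, _, f, .and φ ψ => .and (φ.rename g f) (ψ.rename g f)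
  | _, _, f, .ball t φ => .ball (t.rename f) (φ.rename g (Fin.cons 0 fun i => (f i).succ))

theorem NumTerm.eval_rename {n n' : ℕ} (f : Fin n → Fin n') (t : NumTerm n) (v : Fin n' → M) :
    (t.rename f).eval v = t.eval (v ∘ f) := by
  induction t with
  | var i => rfl
  | zero => rfl
  | one => rfl
  | add s t hs ht => simp only [rename, eval, hs, ht]
  | mul s t hs ht => simp only [rename, eval, hs, ht]

theorem BddFormula.sat_rename {k k' : ℕ} (g : Fin k → Fin k') (X : Fin k' → Set M) {n : ℕ}
    (φ : BddFormula k n) : ∀ {n' : ℕ} (f : Fin n → Fin n') (v : Fin n' → M),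
      (φ.rename g f).Sat X v ↔ φ.Sat (X ∘ g) (v ∘ f) := by
  induction φ with
  | eq s t => intro n' f v; simp only [rename, Sat, NumTerm.eval_rename]
  | lt s t => intro n' f v; simp only [rename, Sat, NumTerm.eval_rename]
  | mem t i => intro n' f v; simp only [rename, Sat, NumTerm.eval_rename, Function.comp]
  | neg φ ih => intro n' f v; simp only [rename, Sat, ih]
  | and φ ψ h₁ h₂ => intro n' f v; simp only [rename, Sat, h₁, h₂]
  | ball t φ ih =>
    intro n' f v
    simp only [rename, Sat, NumTerm.eval_rename, ih]
    refine forall_congr' fun a => imp_congr_right fun _ => ?_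
    have : (Fin.cons a v : Fin (n' + 1) → M) ∘ (Fin.cons 0 fun i => (f i).succ) =
        Fin.cons a (v ∘ f) := by
      funext i
      refine Fin.cases ?_ (fun j => ?_) i <;> simp
    rw [this]

/-- The assignment in which every variable is either one of the arguments `v` or a parameter. -/
def assign {n N : ℕ} (e : Fin N → Fin n ⊕ M) (v : Fin n → M) (i : Fin N) : M :=
  Sum.elim v id (e i)

/-- `f` is given by a term in arguments and parameters. -/
def TermRep {n : ℕ} (f : (Fin n → M) → M) : Prop :=
  ∃ (N : ℕ) (t : NumTerm N) (e : Fin N → Fin n ⊕ M), ∀ v, f v = t.eval (assign e v)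

/-- `P` is given by a bounded formula in arguments and parameters. -/
def BddRep (S : Set (Set M)) {n : ℕ} (P : (Fin n → M) → Prop) : Prop :=
  ∃ (k N : ℕ) (θ : BddFormula k N) (X : Fin k → Set M) (e : Fin N → Fin n ⊕ M),
    (∀ i, X i ∈ S) ∧ ∀ v, P v ↔ θ.Sat X (assign e v)

theorem assign_append_castAdd {n N₁ N₂ : ℕ} (e₁ : Fin N₁ → Fin n ⊕ M) (e₂ : Fin N₂ → Fin n ⊕ M)
    (v : Fin n → M) : assign (Fin.append e₁ e₂) v ∘ Fin.castAdd N₂ = assign e₁ v := by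
  funext i; simp [assign]

theorem assign_append_natAdd {n N₁ N₂ : ℕ} (e₁ : Fin N₁ → Fin n ⊕ M) (e₂ : Fin N₂ → Fin n ⊕ M)
    (v : Fin n → M) : assign (Fin.append e₁ e₂) v ∘ Fin.natAdd N₁ = assign e₂ v := by
  funext i; simp [assign]

theorem TermRep.merge {n : ℕ} {f g : (Fin n → M) → M} (hf : TermRep f) (hg : TermRep g) :
    ∃ (N : ℕ) (s t : NumTerm N) (e : Fin N → Fin n ⊕ M),
      (∀ v, f v = s.eval (assign e v)) ∧ ∀ v, g v = t.eval (assign e v) := by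
  obtain ⟨N₁, s, e₁, hs⟩ := hf
  obtain ⟨N₂, t, e₂, ht⟩ := hg
  refine ⟨N₁ + N₂, s.rename (Fin.castAdd N₂), t.rename (Fin.natAdd N₁), Fin.append e₁ e₂, ?_, ?_⟩
  · intro v; rw [hs, NumTerm.eval_rename, assign_append_castAdd]
  · intro v; rw [ht, NumTerm.eval_rename, assign_append_natAdd]

theorem IsTerm.rep {n : ℕ} {f : (Fin n → M) → M} (hf : IsTerm n f) : TermRep f := by
  induction hf with
  | const c => exact ⟨1, .var 0, fun _ => .inr c, fun v => rfl⟩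
  | var i => exact ⟨1, .var 0, fun _ => .inl i, fun v => rfl⟩
  | add _ _ hf hg =>
    obtain ⟨N, s, t, e, hs, ht⟩ := hf.merge hg
    exact ⟨N, .add s t, e, fun v => by simp only [hs, ht]; rfl⟩
  | mul _ _ hf hg =>
    obtain ⟨N, s, t, e, hs, ht⟩ := hf.merge hg
    exact ⟨N, .mul s t, e, fun v => by simp only [hs, ht]; rfl⟩

theorem BddRep.not {S : Set (Set M)} {n : ℕ} {P : (Fin n → M) → Prop} (h : BddRep S P) :
    BddRep S fun v => ¬ P v := by
  obtain ⟨k, N, θ, X, e, hX, h⟩ := h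
  exact ⟨k, N, .neg θ, X, e, hX, fun v => not_congr (h v)⟩

theorem BddRep.and {S : Set (Set M)} {n : ℕ} {P Q : (Fin n → M) → Prop} (hP : BddRep S P)
    (hQ : BddRep S Q) : BddRep S fun v => P v ∧ Q v := by
  obtain ⟨k₁, N₁, θ₁, X₁, e₁, hX₁, h₁⟩ := hP
  obtain ⟨k₂, N₂, θ₂, X₂, e₂, hX₂, h₂⟩ := hQ
  refine ⟨k₁ + k₂, N₁ + N₂, .and (θ₁.rename (Fin.castAdd k₂) (Fin.castAdd N₂))
    (θ₂.rename (Fin.natAdd k₁) (Fin.natAdd N₁)), Fin.append X₁ X₂, Fin.append e₁ e₂, ?_, ?_⟩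
  · intro i
    refine Fin.addCases (fun j => ?_) (fun j => ?_) i
    · simpa using hX₁ j
    · simpa using hX₂ j
  · intro v
    have e₁' : Fin.append X₁ X₂ ∘ Fin.castAdd k₂ = X₁ := by funext i; simp
    have e₂' : Fin.append X₁ X₂ ∘ Fin.natAdd k₁ = X₂ := by funext i; simp
    simp only [BddFormula.Sat, BddFormula.sat_rename, assign_append_castAdd,
      assign_append_natAdd, e₁', e₂']
    exact and_congr (h₁ v) (h₂ v)

theorem BddRep.congr {S : Set (Set M)} {n : ℕ} {P Q : (Fin n → M) → Prop} (hP : BddRep S P)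
    (h : ∀ v, Q v ↔ P v) : BddRep S Q := by
  rwa [show Q = P from funext fun v => propext (h v)]

theorem BddRep.ball {S : Set (Set M)} {n : ℕ} {t : (Fin n → M) → M}
    {P : (Fin n → M) → M → Prop} (ht : TermRep t)
    (hP : BddRep S fun w : Fin (n + 1) → M => P (Fin.tail w) (w 0)) :
    BddRep S fun v => ∀ a, a < t v → P v a := by
  classical
  obtain ⟨N₁, s, e₁, hs⟩ := ht
  obtain ⟨k, N₂, θ, X, e₂, hX, h⟩ := hP
  -- `e` fills the places of the bound variable with a dummy parameter `0`; `f` redirects these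
  -- places to variable `0`.
  let e : Fin N₂ → Fin n ⊕ M := fun i =>
    Sum.elim (Fin.cases (Sum.inr 0) fun j => Sum.inl j) Sum.inr (e₂ i)
  let f : Fin N₂ → Fin (N₁ + N₂ + 1) := fun i =>
    if e₂ i = .inl 0 then 0 else (Fin.natAdd N₁ i).succ
  refine ⟨k, N₁ + N₂, .ball (s.rename (Fin.castAdd N₂)) (θ.rename id f), X, Fin.append e₁ e, hX,
    fun v => ?_⟩
  simp only [BddFormula.Sat, BddFormula.sat_rename, NumTerm.eval_rename, assign_append_castAdd,
    ← hs, Function.comp_id]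
  refine forall_congr' fun a => imp_congr_right fun _ => ?_
  have : (Fin.cons a (assign (Fin.append e₁ e) v) : Fin (N₁ + N₂ + 1) → M) ∘ f =
      assign e₂ (Fin.cons a v) := by
    funext i
    by_cases hi : e₂ i = .inl 0
    · simp [f, hi, assign]
    · simp only [f, hi, if_false, Function.comp, Fin.cons_succ]
      simp only [assign, Fin.append_right, e]
      rcases hj : e₂ i with j | c
      · revert hi
        rw [hj]
        refine Fin.cases ?_ (fun j => ?_) j <;> simp
      · simp
  rw [this, ← h]
  simp

theorem IsBdd.rep {S : Set (Set M)} {n : ℕ} {P : (Fin n → M) → Prop} (hP : IsBdd S n P) :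
    BddRep S P := by
  induction hP with
  | eq hf hg =>
    obtain ⟨N, s, t, e, hs, ht⟩ := hf.rep.merge hg.rep
    exact ⟨0, N, .eq s t, Fin.elim0, e, fun i => i.elim0, fun v => by simp only [hs, ht]; rfl⟩
  | lt hf hg =>
    obtain ⟨N, s, t, e, hs, ht⟩ := hf.rep.merge hg.rep
    exact ⟨0, N, .lt s t, Fin.elim0, e, fun i => i.elim0, fun v => by simp only [hs, ht]; rfl⟩
  | @mem _ _ A hA hf =>
    obtain ⟨N, s, e, hs⟩ := hf.rep
    exact ⟨1, N, .mem s 0, fun _ => A, e, fun _ => hA, fun v => by simp only [hs]; rfl⟩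
  | not _ h => exact h.not
  | and _ _ hP hQ => exact hP.and hQ
  | or _ _ hP hQ => exact (hP.not.and hQ.not).not.congr fun v => by tauto
  | ball ht _ h => exact h.ball ht.rep
  | @bex _ t P ht _ h =>
    refine (BddRep.ball (P := fun v a => ¬ P v a) ht.rep h.not).not.congr fun v => ?_
    push Not
    rfl

theorem IsTerm.comp_eval {N : ℕ} (t : NumTerm N) {n : ℕ} {e : Fin N → (Fin n → M) → M}
    (he : ∀ i, IsTerm n (e i)) : IsTerm n fun v => t.eval fun i => e i v := by
  induction t with
  | var i => exact he i
  | zero => exact .const 0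
  | one => exact .const 1
  | add s t hs ht => exact .add hs ht
  | mul s t hs ht => exact .mul hs ht

theorem IsTerm.comp_tail {n : ℕ} {f : (Fin n → M) → M} (hf : IsTerm n f) :
    IsTerm (n + 1) fun w => f (Fin.tail w) := by
  induction hf with
  | const c => exact .const c
  | var i => exact .var i.succ
  | add _ _ hs ht => exact .add hs ht
  | mul _ _ hs ht => exact .mul hs ht

/-- The way back from formulas to `IsBdd`, with terms put in for the variables. Combined with
`IsBdd.rep` it yields closure under substitution. -/
theorem IsBdd.sat {S : Set (Set M)} {k N : ℕ} (θ : BddFormula k N) {X : Fin k → Set M}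
    (hX : ∀ i, X i ∈ S) : ∀ {n : ℕ} {e : Fin N → (Fin n → M) → M}, (∀ i, IsTerm n (e i)) →
      IsBdd S n fun v => θ.Sat X fun i => e i v := by
  induction θ with
  | eq s t => intro n e he; exact .eq (.comp_eval s he) (.comp_eval t he)
  | lt s t => intro n e he; exact .lt (.comp_eval s he) (.comp_eval t he)
  | mem t i => intro n e he; exact .mem (hX i) (.comp_eval t he)
  | neg φ ih => intro n e he; exact .not (ih he)
  | and φ ψ h₁ h₂ => intro n e he; exact .and (h₁ he) (h₂ he)
  | @ball N t φ ih =>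
    intro n e he
    refine .ball (P := fun v a => φ.Sat X (Fin.cons a fun i => e i v)) (.comp_eval t he) ?_
    have := ih (n := n + 1) (e := Fin.cons (fun w => w 0) fun i w => e i (Fin.tail w)) (by
      refine Fin.cases (.var 0) fun i => ?_
      exact (he i).comp_tail)
    convert this using 3 with w
    funext i
    refine Fin.cases ?_ (fun j => ?_) i <;> simp

theorem IsBdd.congr {S : Set (Set M)} {n : ℕ} {P Q : (Fin n → M) → Prop} (hP : IsBdd S n P)
    (h : ∀ v, Q v ↔ P v) : IsBdd S n Q := by
  rwa [show Q = P from funext fun v => propext (h v)]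

theorem IsBdd.exists_formula {S : Set (Set M)} {Q : (Fin 2 → M) → Prop} (hQ : IsBdd S 2 Q) :
    ∃ (k n : ℕ) (θ : BddFormula k (n + 2)) (X : Fin k → Set M) (p : Fin n → M),
      (∀ i, X i ∈ S) ∧ ∀ u x, Q ![u, x] ↔ θ.Sat X (Fin.cons u (Fin.cons x p)) := by
  obtain ⟨k, N, θ, X, e, hX, h⟩ := hQ.rep
  -- Parameters sit at the places from `2` on; places that stand for an argument leave an unused
  -- parameter, set to `0`.
  let f : Fin N → Fin (N + 2) := fun i => Sum.elim (Fin.castLE (by omega)) (fun _ => i.succ.succ) (e i)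
  refine ⟨k, N, θ.rename id f, X, fun i => Sum.elim (fun _ => 0) id (e i), hX, fun u x => ?_⟩
  rw [h, BddFormula.sat_rename, Function.comp_id]
  have : assign e ![u, x] = (Fin.cons u (Fin.cons x fun i => Sum.elim (fun _ => 0) id (e i)) :
      Fin (N + 2) → M) ∘ f := by
    funext i
    simp only [assign, Function.comp, f]
    rcases hj : e i with j | c
    · fin_cases j <;> rfl
    · simp [hj]
  rw [this]

theorem IsBdd.isSigma01 {S : Set (Set M)} {Q : M → M → Prop}
    (hQ : IsBdd S 2 fun v => Q (v 0) (v 1)) : IsSigma01 S fun x => ∃ u, Q u x := by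
  obtain ⟨k, n, θ, X, p, hX, h⟩ := hQ.exists_formula
  exact ⟨k, n, θ, X, p, hX, fun x => exists_congr fun u => h u x⟩

theorem IsBdd.isPi01 {S : Set (Set M)} {Q : M → M → Prop}
    (hQ : IsBdd S 2 fun v => Q (v 0) (v 1)) : IsPi01 S fun x => ∀ u, Q u x := by
  obtain ⟨k, n, θ, X, p, hX, h⟩ := hQ.exists_formula
  exact ⟨k, n, θ, X, p, hX, fun x => forall_congr' fun u => h u x⟩

theorem ModelsRCA0.induction_exists {S : Set (Set M)} (h : ModelsRCA0 S) {Q : M → M → Prop}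
    (hQ : IsBdd S 2 fun v => Q (v 0) (v 1)) (h0 : ∃ u, Q u 0)
    (hs : ∀ x, (∃ u, Q u x) → ∃ u, Q u (x + 1)) : ∀ x, ∃ u, Q u x :=
  h.sigma01_induction _ hQ.isSigma01 h0 hs

/-- Variable `0` is reserved for a vacuous existential quantifier, so the argument of `P` is
variable `1`. -/
theorem ModelsRCA0.induction_bdd {S : Set (Set M)} (h : ModelsRCA0 S) {P : M → Prop}
    (hP : IsBdd S 2 fun v => P (v 1)) (h0 : P 0) (hs : ∀ x, P x → P (x + 1)) : ∀ x, P x :=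
  h.sigma01_induction _ (by simpa using hP.isSigma01 (Q := fun _ x => P x)) h0 hs

theorem ModelsRCA0.exists_set {S : Set (Set M)} (h : ModelsRCA0 S) {P : M → Prop}
    (hP : IsBdd S 2 fun v => P (v 1)) : ∃ A ∈ S, ∀ x, x ∈ A ↔ P x :=
  h.delta01_comprehension P P (by simpa using hP.isSigma01 (Q := fun _ x => P x))
    (by simpa using hP.isPi01 (Q := fun _ x => P x)) fun _ => Iff.rfl

end Definability

/-! ### Arithmetic in a model: an ordered commutative semiring. -/

namespace ModelsRCA0

variable {M : Type*} [Zero M] [One M] [Add M] [Mul M] [LT M] {S : Set (Set M)}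

theorem zero_add (h : ModelsRCA0 S) (x : M) : 0 + x = x :=
  h.induction_bdd (P := fun x => 0 + x = x) (by repeat' constructor) (h.add_zero 0)
    (fun x hx => by rw [h.add_succ, hx]) x

theorem succ_add (h : ModelsRCA0 S) (x y : M) : x + 1 + y = x + y + 1 :=
  h.induction_bdd (P := fun y => x + 1 + y = x + y + 1) (by repeat' constructor)
    (by rw [h.add_zero, h.add_zero]) (fun y hy => by rw [h.add_succ, hy, h.add_succ]) y

theorem add_comm (h : ModelsRCA0 S) (x y : M) : x + y = y + x :=
  h.induction_bdd (P := fun y => x + y = y + x) (by repeat' constructor)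
    (by rw [h.add_zero, h.zero_add]) (fun y hy => by rw [h.add_succ, hy, h.succ_add]) y

theorem add_assoc (h : ModelsRCA0 S) (x y z : M) : x + y + z = x + (y + z) :=
  h.induction_bdd (P := fun z => x + y + z = x + (y + z)) (by repeat' constructor)
    (by rw [h.add_zero, h.add_zero]) (fun z hz => by simp only [h.add_succ, hz]) z

theorem mul_add (h : ModelsRCA0 S) (x y z : M) : x * (y + z) = x * y + x * z :=
  h.induction_bdd (P := fun z => x * (y + z) = x * y + x * z) (by repeat' constructor)
    (by rw [h.add_zero, h.mul_zero, h.add_zero])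
    (fun z hz => by rw [h.add_succ, h.mul_succ, hz, h.mul_succ, h.add_assoc]) z

theorem zero_mul (h : ModelsRCA0 S) (x : M) : 0 * x = 0 :=
  h.induction_bdd (P := fun x => 0 * x = 0) (by repeat' constructor) (h.mul_zero 0)
    (fun x hx => by rw [h.mul_succ, hx, h.add_zero]) x

theorem add_right_comm (h : ModelsRCA0 S) (x y z : M) : x + y + z = x + z + y := by
  rw [h.add_assoc, h.add_comm y, ← h.add_assoc]

theorem succ_mul (h : ModelsRCA0 S) (x y : M) : (x + 1) * y = x * y + y :=
  h.induction_bdd (P := fun y => (x + 1) * y = x * y + y) (by repeat' constructor)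
    (by rw [h.mul_zero, h.mul_zero, h.add_zero])
    (fun y hy => by
      rw [h.mul_succ, hy, h.mul_succ, h.add_succ, h.add_succ, h.add_right_comm (x * y) y x]) y

theorem mul_comm (h : ModelsRCA0 S) (x y : M) : x * y = y * x :=
  h.induction_bdd (P := fun y => x * y = y * x) (by repeat' constructor)
    (by rw [h.mul_zero, h.zero_mul]) (fun y hy => by rw [h.mul_succ, hy, h.succ_mul]) y

theorem mul_assoc (h : ModelsRCA0 S) (x y z : M) : x * y * z = x * (y * z) :=
  h.induction_bdd (P := fun z => x * y * z = x * (y * z)) (by repeat' constructor)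
    (by simp only [h.mul_zero]) (fun z hz => by rw [h.mul_succ, hz, h.mul_succ, h.mul_add]) z

theorem mul_one (h : ModelsRCA0 S) (x : M) : x * 1 = x := by
  rw [← h.zero_add 1, h.mul_succ, h.mul_zero, h.zero_add]

theorem eq_zero_or_succ (h : ModelsRCA0 S) (x : M) : x = 0 ∨ ∃ y, x = y + 1 := by
  obtain ⟨y, hy⟩ := h.induction_exists (Q := fun y x => x = 0 ∨ x = y + 1)
    (by repeat' constructor) ⟨0, .inl rfl⟩ (fun x _ => ⟨x, .inr rfl⟩) x
  exact hy.imp id fun hy => ⟨y, hy⟩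

theorem add_right_cancel (h : ModelsRCA0 S) (a b c : M) : a + c = b + c → a = b := by
  have := h.induction_bdd (P := fun c => a + c = b + c → a = b)
    ((IsBdd.or (.not (P := fun v : Fin 2 → M => a + v 1 = b + v 1) (by repeat' constructor))
      (by repeat' constructor : IsBdd S 2 fun _ : Fin 2 → M => a = b)).congr
      fun v => by tauto)
  refine this (by rw [h.add_zero, h.add_zero]; exact id) (fun c hc e => hc ?_) c
  rw [h.add_succ, h.add_succ] at e
  exact h.succ_inj _ _ e

theorem lt_add_succ (h : ModelsRCA0 S) (a c : M) : a < a + (c + 1) :=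
  h.induction_bdd (P := fun c => a < a + (c + 1)) (by repeat' constructor)
    (by rw [h.add_succ, h.add_zero, h.lt_succ_iff]; exact .inr rfl)
    (fun c hc => by rw [h.add_succ, h.lt_succ_iff]; exact .inl hc) c

theorem lt_iff (h : ModelsRCA0 S) (a b : M) : a < b ↔ ∃ c, b = a + (c + 1) := by
  refine ⟨?_, fun ⟨c, hc⟩ => hc ▸ h.lt_add_succ a c⟩
  -- The implication becomes a disjunction under the existential quantifier, so that `Σ⁰₁`-induction
  -- on `b` applies.
  obtain ⟨c, hc⟩ := h.induction_exists (Q := fun c b => ¬ a < b ∨ b = a + (c + 1))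
    (by repeat' constructor) ⟨0, .inl (h.not_lt_zero a)⟩ (by
      rintro b ⟨c, hc⟩
      by_cases hb : a < b + 1
      · rcases (h.lt_succ_iff _ _).1 hb with hb | rfl
        · exact ⟨c + 1, .inr (by rw [hc.resolve_left (not_not.2 hb), h.add_succ a (c + 1)])⟩
        · exact ⟨0, .inr (by rw [h.zero_add])⟩
      · exact ⟨0, .inl hb⟩) b
  exact fun hb => ⟨c, hc.resolve_left (not_not.2 hb)⟩

theorem lt_irrefl (h : ModelsRCA0 S) (a : M) : ¬ a < a := by
  rw [h.lt_iff]
  rintro ⟨c, hc⟩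
  refine h.succ_ne_zero c (h.add_right_cancel _ _ a ?_)
  rw [h.add_comm, ← hc, h.zero_add]

theorem lt_trans (h : ModelsRCA0 S) {a b c : M} (hab : a < b) (hbc : b < c) : a < c := by
  rw [h.lt_iff] at *
  obtain ⟨x, rfl⟩ := hab
  obtain ⟨y, rfl⟩ := hbc
  exact ⟨x + 1 + y, by rw [h.add_assoc, h.add_succ (x + 1)]⟩

theorem lt_trichotomy (h : ModelsRCA0 S) (a b : M) : a < b ∨ a = b ∨ b < a := by
  refine h.induction_bdd (P := fun b => a < b ∨ a = b ∨ b < a) (by repeat' constructor) ?_ ?_ b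
  · rcases h.eq_zero_or_succ a with rfl | ⟨y, rfl⟩
    · exact .inr (.inl rfl)
    · exact .inr (.inr ((h.lt_iff _ _).2 ⟨y, by rw [h.zero_add]⟩))
  · rintro b (hb | rfl | hb)
    · exact .inl ((h.lt_succ_iff _ _).2 (.inl hb))
    · exact .inl ((h.lt_succ_iff _ _).2 (.inr rfl))
    · obtain ⟨c, rfl⟩ := (h.lt_iff _ _).1 hb
      rcases h.eq_zero_or_succ c with rfl | ⟨d, rfl⟩
      · exact .inr (.inl (by rw [h.zero_add]))
      · refine .inr (.inr ((h.lt_iff _ _).2 ⟨d, ?_⟩))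
        rw [h.add_succ b, h.succ_add]

theorem add_lt_add_left (h : ModelsRCA0 S) {a b : M} (hab : a < b) (c : M) : c + a < c + b := by
  rw [h.lt_iff] at *
  obtain ⟨x, rfl⟩ := hab
  exact ⟨x, by rw [h.add_assoc]⟩

theorem mul_lt_mul_left (h : ModelsRCA0 S) {a b c : M} (hab : a < b) (hc : 0 < c) :
    c * a < c * b := by
  rw [h.lt_iff] at *
  obtain ⟨x, rfl⟩ := hab
  obtain ⟨y, rfl⟩ := hc
  exact ⟨(y + 1) * x + y, by rw [h.zero_add, h.mul_add, h.mul_succ, h.add_succ ((y + 1) * x)]⟩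

/-- The number domain of a model of `RCA₀` is a commutative semiring. -/
@[reducible] def commSemiring (h : ModelsRCA0 S) : CommSemiring M where
  add_assoc := h.add_assoc
  zero_add := h.zero_add
  add_zero := h.add_zero
  add_comm := h.add_comm
  left_distrib := h.mul_add
  right_distrib a b c := by rw [h.mul_comm, h.mul_add, h.mul_comm c, h.mul_comm c]
  zero_mul := h.zero_mul
  mul_zero := h.mul_zero
  mul_assoc := h.mul_assoc
  one_mul a := by rw [h.mul_comm, h.mul_one]
  mul_one := h.mul_one
  mul_comm := h.mul_comm
  nsmul := nsmulRec

open Classical in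
/-- The number domain of a model of `RCA₀` is linearly ordered. -/
@[reducible] noncomputable def linearOrder (h : ModelsRCA0 S) : LinearOrder M where
  le a b := a < b ∨ a = b
  lt a b := a < b
  le_refl a := .inr rfl
  le_trans := by
    rintro a b c (hab | rfl) (hbc | rfl)
    · exact .inl (h.lt_trans hab hbc)
    · exact .inl hab
    · exact .inl hbc
    · exact .inr rfl
  lt_iff_le_not_ge a b := by
    constructor
    · intro hab
      refine ⟨.inl hab, ?_⟩
      rintro (hba | rfl)
      · exact h.lt_irrefl _ (h.lt_trans hab hba)
      · exact h.lt_irrefl _ hab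
    · rintro ⟨hab | rfl, hba⟩
      · exact hab
      · exact absurd (.inr rfl) hba
  le_antisymm := by
    rintro a b (hab | rfl) (hba | hba)
    · exact (h.lt_irrefl _ (h.lt_trans hab hba)).elim
    · exact hba.symm
    · rfl
    · rfl
  le_total a b := by
    rcases h.lt_trichotomy a b with hab | rfl | hab
    · exact .inl (.inl hab)
    · exact .inl (.inr rfl)
    · exact .inr (.inl hab)
  toDecidableLE := fun _ _ => Classical.dec _

theorem isStrictOrderedRing (h : ModelsRCA0 S) :
    letI := h.commSemiring
    letI := h.linearOrder
    IsStrictOrderedRing M := by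
  let := h.commSemiring
  let := h.linearOrder
  have : IsOrderedCancelAddMonoid M :=
    { add_le_add_left := by
        rintro a b (hab | rfl) c
        · refine Or.inl ?_
          rw [h.add_comm a, h.add_comm b]
          exact h.add_lt_add_left hab c
        · exact Or.inr rfl
      le_of_add_le_add_left := by
        rintro a b c habc
        rcases h.lt_trichotomy b c with hbc | rfl | hbc
        · exact .inl hbc
        · exact .inr rfl
        · exact absurd habc (not_le_of_gt (h.add_lt_add_left hbc a)) }
  have h01 : (0 : M) < 1 := (h.lt_iff _ _).2 ⟨0, by rw [h.zero_add, h.zero_add]⟩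
  exact
    { zero_le_one := h01.le
      exists_pair_ne := ⟨0, 1, h01.ne⟩
      mul_lt_mul_of_pos_left := fun c hc a b hab => h.mul_lt_mul_left hab hc
      mul_lt_mul_of_pos_right := fun c hc a b hab => by
        show a * c < b * c
        rw [h.mul_comm a, h.mul_comm b]
        exact h.mul_lt_mul_left hab hc }

theorem canonicallyOrderedAdd (h : ModelsRCA0 S) :
    letI := h.commSemiring
    letI := h.linearOrder
    CanonicallyOrderedAdd M := by
  let := h.commSemiring
  let := h.linearOrder
  have key : ∀ a b : M, a ≤ a + b := by
    intro a b
    rcases h.eq_zero_or_succ b with rfl | ⟨c, rfl⟩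
    · exact .inr (h.add_zero a).symm
    · exact .inl (h.lt_add_succ a c)
  exact
    { exists_add_of_le := by
        rintro a b (hab | rfl)
        · obtain ⟨c, rfl⟩ := (h.lt_iff _ _).1 hab
          exact ⟨c + 1, rfl⟩
        · exact ⟨0, (h.add_zero a).symm⟩
      le_add_self := fun a b => by rw [h.add_comm]; exact key a b
      le_self_add := key }

end ModelsRCA0

/-! ### `Σ⁰₁` relations, extremal elements and collection. -/

section Sigma

variable {M : Type*} [CommSemiring M] [LinearOrder M] {S : Set (Set M)}

theorem IsBdd.subst {n m : ℕ} {P : (Fin n → M) → Prop} (hP : IsBdd S n P)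
    {e : Fin n → (Fin m → M) → M} (he : ∀ i, IsTerm m (e i)) :
    IsBdd S m fun v => P fun i => e i v := by
  obtain ⟨k, N, θ, X, d, hX, h⟩ := hP.rep
  refine (IsBdd.sat θ hX (e := fun i v => assign d (fun j => e j v) i) fun i => ?_).congr
    fun v => h _
  simp only [assign]
  rcases d i with j | c
  · exact he j
  · exact .const c

theorem IsBdd.comp₂ {Q : M → M → Prop} (hQ : IsBdd S 2 fun v => Q (v 0) (v 1)) {n : ℕ}
    {f g : (Fin n → M) → M} (hf : IsTerm n f) (hg : IsTerm n g) :
    IsBdd S n fun v => Q (f v) (g v) :=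
  hQ.subst (e := ![f, g]) (by intro i; fin_cases i <;> assumption)

theorem IsBdd.comp₃ {Q : M → M → M → Prop} (hQ : IsBdd S 3 fun v => Q (v 0) (v 1) (v 2)) {n : ℕ}
    {f g k : (Fin n → M) → M} (hf : IsTerm n f) (hg : IsTerm n g) (hk : IsTerm n k) :
    IsBdd S n fun v => Q (f v) (g v) (k v) :=
  hQ.subst (e := ![f, g, k]) (by intro i; fin_cases i <;> assumption)

theorem IsBdd.le {n : ℕ} {f g : (Fin n → M) → M} (hf : IsTerm n f) (hg : IsTerm n g) :
    IsBdd S n fun v => f v ≤ g v :=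
  (IsBdd.not (.lt hg hf)).congr fun _ => not_lt.symm

theorem IsTerm.pair {n : ℕ} {f g : (Fin n → M) → M} (hf : IsTerm n f) (hg : IsTerm n g) :
    IsTerm n fun v => pair (f v) (g v) :=
  .add (.mul (.add hf hg) (.add hf hg)) hf

/-- Relations of `n` numbers that are given by `Σ⁰₁` formulas with parameters. -/
inductive IsSigma (S : Set (Set M)) : (n : ℕ) → ((Fin n → M) → Prop) → Prop
  | ex {n : ℕ} {P : (Fin n → M) → M → Prop} :
      IsSigma S (n + 1) (fun w => P (Fin.tail w) (w 0)) → IsSigma S n fun v => ∃ a, P v a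
  | and {n : ℕ} {P Q : (Fin n → M) → Prop} :
      IsSigma S n P → IsSigma S n Q → IsSigma S n fun v => P v ∧ Q v
  | or {n : ℕ} {P Q : (Fin n → M) → Prop} :
      IsSigma S n P → IsSigma S n Q → IsSigma S n fun v => P v ∨ Q v
  | bdd {n : ℕ} {P : (Fin n → M) → Prop} : IsBdd S n P → IsSigma S n P

variable [IsStrictOrderedRing M] [CanonicallyOrderedAdd M]

/-- Two witnesses `a` and `b` are merged into one bound `a + b + 1`, which turns the inner
quantifiers into bounded ones. -/
theorem IsSigma.rep {n : ℕ} {P : (Fin n → M) → Prop} (hP : IsSigma S n P) :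
    ∃ Q : (Fin n → M) → M → Prop, IsBdd S (n + 1) (fun w => Q (Fin.tail w) (w 0)) ∧
      ∀ v, P v ↔ ∃ u, Q v u := by
  have lt₁ : ∀ a b : M, a < a + b + 1 := fun a b => by grind [zero_le (a := b), zero_lt_one (α := M)]
  have lt₂ : ∀ a b : M, b < a + b + 1 := fun a b => by grind [zero_le (a := a), zero_lt_one (α := M)]
  induction hP with
  | @bdd _ P h =>
    exact ⟨fun v _ => P v, h.subst (e := fun i w => w i.succ) fun i => .var _, by simp⟩
  | or _ _ h₁ h₂ =>
    obtain ⟨Q₁, hQ₁, h₁⟩ := h₁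
    obtain ⟨Q₂, hQ₂, h₂⟩ := h₂
    exact ⟨fun v u => Q₁ v u ∨ Q₂ v u, hQ₁.or hQ₂, fun v => by simp only [h₁, h₂, exists_or]⟩
  | and _ _ h₁ h₂ =>
    obtain ⟨Q₁, hQ₁, h₁⟩ := h₁
    obtain ⟨Q₂, hQ₂, h₂⟩ := h₂
    refine ⟨fun v u => (∃ a, a < u ∧ Q₁ v a) ∧ ∃ a, a < u ∧ Q₂ v a, .and ?_ ?_, fun v => ?_⟩
    · refine .bex (.var 0) ?_
      exact hQ₁.subst (e := Fin.cons (fun w => w 0) fun i w => w i.succ.succ)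
        (Fin.cases (.var _) fun i => .var _)
    · refine .bex (.var 0) ?_
      exact hQ₂.subst (e := Fin.cons (fun w => w 0) fun i w => w i.succ.succ)
        (Fin.cases (.var _) fun i => .var _)
    · simp only [h₁, h₂]
      constructor
      · rintro ⟨⟨a, ha⟩, b, hb⟩
        exact ⟨a + b + 1, ⟨a, lt₁ a b, ha⟩, b, lt₂ a b, hb⟩
      · rintro ⟨u, ⟨a, -, ha⟩, b, -, hb⟩
        exact ⟨⟨a, ha⟩, b, hb⟩
  | ex _ h =>
    obtain ⟨Q, hQ, h⟩ := h
    refine ⟨fun v u => ∃ a, a < u ∧ ∃ b, b < u ∧ Q (Fin.cons a v) b, ?_, fun v => ?_⟩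
    · refine .bex (.var 0) (.bex (.var 1) ?_)
      have := hQ.subst (m := _ + 3) (e := Fin.cons (fun w => w 0) (Fin.cons (fun w => w 1)
        fun i w => w i.succ.succ.succ))
        (Fin.cases (.var _) (Fin.cases (.var _) fun i => .var _))
      refine this.congr fun w => ?_
      have e : Fin.cons (Fin.tail w 0) (Fin.tail (Fin.tail (Fin.tail w))) =
        Fin.tail fun i : Fin (_ + 2) => (Fin.cons (fun w => w 0) (Fin.cons (fun w => w 1)
        fun i w => w i.succ.succ.succ) : Fin (_ + 2) → (Fin (_ + 3) → M) → M) i w := by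
        funext i
        refine Fin.cases ?_ (fun j => ?_) i <;> rfl
      rw [e]
      rfl
    · have h' : ∀ a, _ ↔ _ := fun a => h (Fin.cons a v)
      simp only [Fin.tail_cons, Fin.cons_zero] at h'
      simp only [h']
      constructor
      · rintro ⟨a, b, hab⟩
        exact ⟨a + b + 1, a, lt₁ a b, b, lt₂ a b, hab⟩
      · rintro ⟨u, a, -, b, -, hab⟩
        exact ⟨a, b, hab⟩

theorem IsSigma.congr {n : ℕ} {P Q : (Fin n → M) → Prop} (hP : IsSigma S n P)
    (h : ∀ v, Q v ↔ P v) : IsSigma S n Q := by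
  rwa [show Q = P from funext fun v => propext (h v)]

theorem IsSigma.subst {n m : ℕ} {P : (Fin n → M) → Prop} (hP : IsSigma S n P)
    {e : Fin n → (Fin m → M) → M} (he : ∀ i, IsTerm m (e i)) :
    IsSigma S m fun v => P fun i => e i v := by
  obtain ⟨Q, hQ, h⟩ := hP.rep
  refine IsSigma.congr (.ex (.bdd ?_)) fun v => h _
  exact hQ.subst (e := Fin.cons (fun w => w 0) fun i w => e i (Fin.tail w))
    (Fin.cases (.var 0) fun i => (he i).comp_tail)

theorem IsSigma.comp₄ {Q : M → M → M → M → Prop}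
    (hQ : IsSigma S 4 fun v => Q (v 0) (v 1) (v 2) (v 3)) {n : ℕ} {f g k l : (Fin n → M) → M}
    (hf : IsTerm n f) (hg : IsTerm n g) (hk : IsTerm n k) (hl : IsTerm n l) :
    IsSigma S n fun v => Q (f v) (g v) (k v) (l v) :=
  hQ.subst (e := ![f, g, k, l]) (by intro i; fin_cases i <;> assumption)

theorem IsSigma.isSigma01 {P : M → Prop} (hP : IsSigma S 1 fun v => P (v 0)) : IsSigma01 S P := by
  obtain ⟨Q, hQ, h⟩ := hP.rep
  have h' : ∀ x, P x ↔ ∃ u, Q (fun _ => x) u := fun x => h fun _ => x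
  have := IsBdd.isSigma01 (Q := fun u x => Q (fun _ => x) u) (S := S) ?_
  · rwa [show P = _ from funext fun x => propext (h' x)]
  · refine (hQ.subst (e := fun i w => w i) fun i => .var i).congr fun w => ?_
    rw [show (fun _ : Fin 1 => w 1) = Fin.tail fun i => w i from
      funext fun i => by rw [Subsingleton.elim i 0]; rfl]

namespace ModelsRCA0

variable (h : ModelsRCA0 S)
include h

theorem lt_add_one_iff {a b : M} : a < b + 1 ↔ a ≤ b :=
  (h.lt_succ_iff a b).trans le_iff_lt_or_eq.symm

theorem add_one_le_iff {a b : M} : a + 1 ≤ b ↔ a < b := by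
  rw [← h.lt_add_one_iff, add_lt_add_iff_right]

theorem induction {P : M → Prop} (hP : IsSigma S 1 fun v => P (v 0)) (h0 : P 0)
    (hs : ∀ x, P x → P (x + 1)) : ∀ x, P x :=
  h.sigma01_induction P hP.isSigma01 h0 hs

/-- Without a least element one can descend `z` steps from `a` for every `z`, which is absurd for `z
= a + 1`. Phrased this way the induction statement stays `Σ⁰₁`. -/
theorem exists_least {P : M → Prop} (hP : IsSigma S 1 fun v => P (v 0)) (hne : ∃ x, P x) :
    ∃ x, P x ∧ ∀ y, P y → x ≤ y := by
  obtain ⟨a, ha⟩ := hne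
  by_contra! hc
  have key := h.induction (P := fun z => ∃ y, y + z ≤ a ∧ P y)
    (.ex (.and (.bdd (.le (.add (.var 0) (.var 1)) (.const a)))
      (hP.subst (e := fun _ w => w 0) fun _ => .var 0)))
    ⟨a, by grind, ha⟩ (by
      rintro z ⟨y, hy, hPy⟩
      obtain ⟨y', hy', hlt⟩ := hc y hPy
      exact ⟨y', by grind [h.add_one_le_iff.2 hlt], hy'⟩)
  obtain ⟨y, hy, -⟩ := key (a + 1)
  grind [zero_le (a := y), zero_lt_one (α := M)]

theorem exists_greatest {P : M → Prop} (hP : IsSigma S 1 fun v => P (v 0)) (hne : ∃ x, P x)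
    {a : M} (ha : ∀ x, P x → x ≤ a) : ∃ x, P x ∧ ∀ y, P y → y ≤ x := by
  by_contra! hc
  have key := h.induction (P := fun z => ∃ y, z ≤ y ∧ P y)
    (.ex (.and (.bdd (.le (.var 1) (.var 0))) (hP.subst (e := fun _ w => w 0) fun _ => .var 0)))
    (hne.imp fun y hy => ⟨zero_le, hy⟩) (by
      rintro z ⟨y, hy, hPy⟩
      obtain ⟨y', hy', hlt⟩ := hc y hPy
      exact ⟨y', by grind [h.add_one_le_iff.2 hlt], hy'⟩)
  obtain ⟨y, hy, hPy⟩ := key (a + 1)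
  grind [ha y hPy, zero_lt_one (α := M)]

/-- Bounded collection. -/
theorem collection {Q : M → M → Prop} (hQ : IsBdd S 2 fun v => Q (v 0) (v 1)) {t : M}
    (ht : ∀ a, a < t → ∃ u, Q a u) : ∃ w, ∀ a, a < t → ∃ u, u < w ∧ Q a u := by
  -- The disjunct `t ≤ a` lets the induction run over all `x`, although witnesses are known only
  -- below `t`.
  have key := h.induction (P := fun x => ∃ w, ∀ a, a < x → t ≤ a ∨ ∃ u, u < w ∧ Q a u)
    (.ex (.bdd (.ball (.var 1) (.or (.le (.const t) (.var 0))
      (.bex (.var 1) (hQ.comp₂ (.var 1) (.var 0)))))))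
    ⟨0, fun a ha => (h.not_lt_zero a ha).elim⟩ (by
      rintro x ⟨w, hw⟩
      rcases lt_or_ge x t with hx | hx
      · obtain ⟨u, hu⟩ := ht x hx
        refine ⟨w + u + 1, fun a ha => ?_⟩
        rcases (h.lt_succ_iff _ _).1 ha with ha | rfl
        · refine (hw a ha).imp id fun ⟨u', hu', hQ⟩ => ⟨u', ?_, hQ⟩
          grind [zero_le (a := u), zero_lt_one (α := M)]
        · exact .inr ⟨u, by grind [zero_le (a := w), zero_lt_one (α := M)], hu⟩
      · refine ⟨w, fun a ha => ?_⟩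
        rcases (h.lt_succ_iff _ _).1 ha with ha | rfl
        · exact hw a ha
        · exact .inl hx)
  obtain ⟨w, hw⟩ := key t
  exact ⟨w, fun a ha => (hw a ha).resolve_left (not_le.2 ha)⟩

theorem exists_mem_iff {P : M → Prop} (hP : IsBdd S 1 fun v => P (v 0)) :
    ∃ A ∈ S, ∀ x, x ∈ A ↔ P x :=
  h.exists_set (hP.subst (e := fun _ w => w 1) fun _ => .var 1)

theorem eq_zero_or_eq_add_one (a : M) : a = 0 ∨ ∃ b, a = b + 1 :=
  h.eq_zero_or_succ a

end ModelsRCA0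

end Sigma

/-! ### Increasing maps between lexicographic sums of columns. -/

section Columns

variable {M : Type*} [CommSemiring M] [LinearOrder M] [IsStrictOrderedRing M]
  [CanonicallyOrderedAdd M] {S : Set (Set M)}

/-- `G` is the graph of a strictly increasing map, from the lexicographically ordered set of
pairs `(y, t)` with `y < m` and `C y t`, to the lexicographically ordered set of pairs `(y, t)`
with `C' y t`, where all columns `C y` and `C' y` are initial segments. -/
structure IsColumnMap (S : Set (Set M)) (m : M) (C C' : M → M → Prop)
    (G : M → M → M → M → Prop) : Prop where
  sigma : IsSigma S 4 fun v => G (v 0) (v 1) (v 2) (v 3)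
  down : ∀ {y s t}, C y t → s ≤ t → C y s
  down' : ∀ {y s t}, C' y t → s ≤ t → C' y s
  total : ∀ {y t}, y < m → C y t → ∃ y' t', G y t y' t'
  dom : ∀ {y t y' t'}, G y t y' t' → y < m
  cod : ∀ {y t y' t'}, G y t y' t' → C' y' t'
  mono : ∀ {y t y' t' z s z' s'}, G y t y' t' → G z s z' s' → y < z ∨ y = z ∧ t < s →
    y' < z' ∨ y' = z' ∧ t' < s'

namespace IsColumnMap

variable (h : ModelsRCA0 S) {m : M} {C C' : M → M → Prop} {G : M → M → M → M → Prop}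
  (hG : IsColumnMap S m C C' G)
include h hG

/-- After `(y, t)`, column `y` cannot leave column `y'`: monotonicity excludes earlier columns and
`hle` later ones. Hence its images climb at least one place per step. -/
theorem advance {y t y' t' : M} (h₁ : G y t y' t') (hle : ∀ {s z' s'}, G y s z' s' → z' ≤ y')
    {s : M} (hs : C y (t + s)) : ∃ s', t' + s ≤ s' ∧ G y (t + s) y' s' := by
  have key := h.induction (P := fun r => s < r ∨ ∃ s', t' + r ≤ s' ∧ G y (t + r) y' s')
    (.or (.bdd (by repeat' constructor)) (.ex (.and (.bdd (.le (by repeat' constructor) (.var 0)))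
      (hG.sigma.comp₄ (.const y) (.add (.const t) (.var 1)) (.const y') (.var 0)))))
    (.inr ⟨t', by simp, by simpa using h₁⟩) (by
      rintro r hr
      by_cases hrs : s < r + 1
      · exact .inl hrs
      right
      have hrs' : r + 1 ≤ s := not_lt.1 hrs
      obtain ⟨s', hs', hg⟩ := hr.resolve_left (by grind [zero_lt_one (α := M)])
      obtain ⟨z, u, hz⟩ := hG.total (hG.dom h₁)
        (hG.down hs (by grind : t + (r + 1) ≤ t + s))
      rcases hG.mono hg hz (.inr ⟨rfl, by grind [zero_lt_one (α := M)]⟩) with hlt | ⟨rfl, hlt⟩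
      · exact absurd (hle hz) (not_le.2 hlt)
      · exact ⟨u, by grind [h.add_one_le_iff.2 hlt], hz⟩)
  exact (key s).resolve_left (lt_irrefl s)

/-- If column `x` reaches column `x + 1`, then `(x + 1, 0)` goes to some `(x + 1, u)` with `u > 0`.
Climbing from there, column `x + 1` gets ahead of its own argument, so `C' (x + 1)` is all of `M`,
and by `huniv` so is `C x`. But column `x` must stay below `(x + 1, u)`, where `u` further steps do
not fit. -/
theorem not_jump {x t x' t' : M} (hx : x + 1 < m)
    (hnext : ∀ {s z' s'}, G (x + 1) s z' s' → z' ≤ x + 1) (h₀ : C (x + 1) 0)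
    (hsub : ∀ {s}, C' (x + 1) s → C (x + 1) s) (huniv : (∀ s, C' (x + 1) s) → ∀ s, C x s)
    (h₁ : G x t x' t') : x' ≤ x := by
  by_contra! hlt
  obtain ⟨z, u, hz⟩ := hG.total hx h₀
  have hxx : x < x + 1 := lt_add_one x
  have hz' := hnext hz
  have hle := h.add_one_le_iff.2 hlt
  obtain ⟨rfl, rfl, hu⟩ : x' = x + 1 ∧ z = x + 1 ∧ t' < u := by
    rcases hG.mono h₁ hz (.inl hxx) with hlt | ⟨rfl, hlt⟩
    · exact absurd (hle.trans_lt hlt) (not_lt.2 hz')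
    · exact ⟨le_antisymm hz' hle, le_antisymm hz' hle, hlt⟩
  have hC' : ∀ s, C' (x + 1) s := by
    have key := h.induction (P := fun s => ∃ r s', s ≤ s' ∧ G (x + 1) r (x + 1) s')
      (.ex (.ex (.and (.bdd (.le (.var 2) (.var 0)))
        (hG.sigma.comp₄ (.const (x + 1)) (.var 1) (.const (x + 1)) (.var 0)))))
      ⟨0, u, zero_le, hz⟩ (by
        rintro s ⟨r, s', hs', hg⟩
        obtain ⟨s'', hs'', hg'⟩ := advance h hG hz (fun hg => hnext hg) (s := s)
          (by rw [zero_add]; exact hsub (hG.down' (hG.cod hg) hs'))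
        refine ⟨_, s'', ?_, hg'⟩
        grind [h.add_one_le_iff.2 (zero_le.trans_lt hu)])
    intro s
    obtain ⟨r, s', hs', hg⟩ := key s
    exact hG.down' (hG.cod hg) hs'
  have hbd : ∀ {s z' s'}, G x s z' s' → z' < x + 1 ∨ z' = x + 1 ∧ s' < u := fun hg =>
    hG.mono hg hz (.inl hxx)
  obtain ⟨s', hs', hg⟩ := advance h hG h₁ (fun hg => (hbd hg).elim le_of_lt fun h => h.1.le)
    (s := u) (huniv hC' _)
  rcases hbd hg with h₂ | ⟨-, h₂⟩
  · exact lt_irrefl _ h₂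
  · grind [zero_le (a := t')]

/-- If the last column of an interval is not mapped into later columns, then neither is any other
column of it. -/
theorem le_of_top {w T : M} (hT : T < m) (htop : ∀ {s z' s'}, G T s z' s' → z' ≤ T)
    (h₀ : ∀ {y}, w ≤ y → y < T → C (y + 1) 0)
    (hsub : ∀ {y s}, w ≤ y → y < T → C' (y + 1) s → C (y + 1) s)
    (huniv : ∀ {y}, w ≤ y → y < T → (∀ s, C' (y + 1) s) → ∀ s, C y s) {y s z' s' : M}
    (hwy : w ≤ y) (hyT : y ≤ T) (hg : G y s z' s') : z' ≤ y := by
  by_contra! hlt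
  -- The last column that moves up is not `T`, and its successor does not move up: this is what
  -- `not_jump` refutes.
  obtain ⟨x, ⟨hwx, hxT, t, x', t', hg', hlt'⟩, hmax⟩ := h.exists_greatest
    (P := fun x => w ≤ x ∧ x ≤ T ∧ ∃ t x' t', G x t x' t' ∧ x < x')
    (.and (.bdd (.le (.const w) (.var 0))) (.and (.bdd (.le (.var 0) (.const T)))
      (.ex (.ex (.ex (.and (hG.sigma.comp₄ (.var 3) (.var 2) (.var 1) (.var 0))
        (.bdd (.lt (.var 3) (.var 1)))))))))
    ⟨y, hwy, hyT, s, z', s', hg, hlt⟩ (a := T) fun x hx => hx.2.1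
  have hxT' : x < T := lt_of_le_of_ne hxT fun e => by
    subst e
    exact absurd (htop hg') (not_le.2 hlt')
  have hx1 := h.add_one_le_iff.2 hxT'
  refine absurd (not_jump h hG (hx1.trans_lt hT) (fun {u z u'} hg => ?_) (h₀ hwx hxT')
    (hsub hwx hxT') (huniv hwx hxT') hg') (not_le.2 hlt')
  by_contra! hlt
  exact absurd (hmax (x + 1) ⟨hwx.trans (lt_add_one x).le, hx1, u, z, u', hg, hlt⟩)
    (not_le.2 (lt_add_one x))

/-- If column `x` started in column `x`, it would climb there to height `s₀` or more. -/
theorem lt_of_not_subset {x s₀ : M} (hx : x < m) (hle : ∀ {s z' s'}, G x s z' s' → z' ≤ x)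
    (h₁ : C x s₀) (h₂ : ¬ C' x s₀) : ∃ y' t', y' < x ∧ G x 0 y' t' := by
  obtain ⟨y', t', hg⟩ := hG.total hx (hG.down h₁ zero_le)
  rcases (hle hg).lt_or_eq with hlt | rfl
  · exact ⟨y', t', hlt, hg⟩
  · obtain ⟨s', hs', hg'⟩ := advance h hG hg hle (s := s₀) (by rwa [zero_add])
    exact absurd (hG.down' (hG.cod hg') ((le_add_self).trans hs')) h₂

/-- Column `y` stays below `(y', t')`. If it started in column `y`, then `y' = y`, and `hsub` makes
`t'` a place of column `y` whose image is at height at least `t'`. -/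
theorem lt_of_succ {y : M} (h₁ : ∃ y' t', y' < y + 1 ∧ G (y + 1) 0 y' t')
    (h₀ : C y 0) (hsub : ∀ {s}, C' y s → C y s) : ∃ y' t', y' < y ∧ G y 0 y' t' := by
  obtain ⟨y', t', hlt, hg⟩ := h₁
  have hy : y < y + 1 := lt_add_one y
  obtain ⟨z, u, hz⟩ := hG.total (hy.trans (hG.dom hg)) h₀
  have hbd : ∀ {s z' s'}, G y s z' s' → z' < y' ∨ z' = y' ∧ s' < t' := fun hg' =>
    hG.mono hg' hg (.inl hy)
  have hle := h.lt_add_one_iff.1 hlt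
  rcases lt_or_ge z y with hzy | hzy
  · exact ⟨z, u, hzy, hz⟩
  · obtain ⟨rfl, rfl⟩ : z = y ∧ y' = z := by
      rcases hbd hz with h₂ | ⟨h₂, -⟩ <;> constructor <;> grind
    obtain ⟨s', hs', hg'⟩ := advance h hG hz
      (fun hg => (hbd hg).elim le_of_lt fun h => h.1.le) (s := t')
      (by rw [zero_add]; exact hsub (hG.cod hg))
    rcases hbd hg' with h₂ | ⟨-, h₂⟩
    · exact absurd h₂ (lt_irrefl _)
    · grind [zero_le (a := u)]

theorem lt_of_lt {w x : M} (hwx : w ≤ x) (h₁ : ∃ y' t', y' < x ∧ G x 0 y' t')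
    (h₀ : ∀ {y}, w ≤ y → y < x → C y 0) (hsub : ∀ {y s}, w ≤ y → y < x → C' y s → C y s) :
    ∃ y' t', y' < w ∧ G w 0 y' t' := by
  obtain ⟨y, ⟨hwy, hyx, h₂⟩, hmin⟩ := h.exists_least
    (P := fun y => w ≤ y ∧ y ≤ x ∧ ∃ y' t', y' < y ∧ G y 0 y' t')
    (.and (.bdd (.le (.const w) (.var 0))) (.and (.bdd (.le (.var 0) (.const x)))
      (.ex (.ex (.and (.bdd (.lt (.var 1) (.var 2)))
        (hG.sigma.comp₄ (.var 2) (.const 0) (.var 1) (.var 0)))))))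
    ⟨x, hwx, le_rfl, h₁⟩
  rcases hwy.eq_or_lt with rfl | hwy
  · exact h₂
  · obtain rfl | ⟨z, rfl⟩ := h.eq_zero_or_eq_add_one y
    · exact (h.not_lt_zero _ hwy).elim
    · have hz := h.lt_add_one_iff.1 hwy
      have hzx := h.add_one_le_iff.1 hyx
      exact absurd (hmin z ⟨hz, hzx.le, lt_of_succ h hG h₂ (h₀ hz hzx) (hsub hz hzx)⟩)
        (not_le.2 (lt_add_one z))

/-- The map that goes one column further, on the columns before `k`. -/
theorem shift {k : M} (hk : k ≤ m) :
    IsColumnMap S k C (fun y t => ∃ z, y = z + 1 ∧ C' z t)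
      fun y t y' t' => y < k ∧ ∃ z, y' = z + 1 ∧ G y t z t' where
  sigma := .and (.bdd (.lt (.var 0) (.const k))) (.ex (.and
    (.bdd (.eq (.var 3) (.add (.var 0) (.const 1))))
    (hG.sigma.comp₄ (.var 1) (.var 2) (.var 0) (.var 4))))
  down := hG.down
  down' := fun ⟨z, hz, hc⟩ hs => ⟨z, hz, hG.down' hc hs⟩
  total := fun hy hc =>
    let ⟨z, t', hg⟩ := hG.total (hy.trans_le hk) hc
    ⟨z + 1, t', hy, z, rfl, hg⟩
  dom := fun hg => hg.1
  cod := fun ⟨_, z, hz, hg⟩ => ⟨z, hz, hG.cod hg⟩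
  mono := by
    rintro y t _ t' z s _ s' ⟨-, y', rfl, hg⟩ ⟨-, z', rfl, hg'⟩ hlt
    simpa using hG.mono hg hg' hlt

end IsColumnMap

end Columns

/-! ### The orders built from a cut, and why none embeds into another. -/

section Antichain

variable {M : Type*} [CommSemiring M] [LinearOrder M] [IsStrictOrderedRing M]
  [CanonicallyOrderedAdd M] {S : Set (Set M)}

/-- `E` describes, for every `x ≤ b`, the initial segment of all `r` with `E x r`; the set of all
`x` for which this initial segment is bounded is a cut, and the bounds are unbounded. -/
structure IsCutFamily (S : Set (Set M)) (b : M) (E : M → M → Prop) : Prop where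
  sigma : IsSigma S 2 fun v => E (v 0) (v 1)
  down : ∀ {x r s}, E x s → r ≤ s → E x r
  mono : ∀ {x y r}, E x r → x ≤ y → E y r
  pred : ∀ {x}, (∀ r, E (x + 1) r) → ∀ r, E x r
  top : ∀ r, E b r
  base : ∀ x, E x 0
  zero : ∃ r, ¬ E 0 r
  unbounded : ∀ r, ∃ x, E x r ∧ ∃ s, ¬ E x s

/-- The columns of the first half of the `i`-th order. They grow with `i`. -/
def growing (E : M → M → Prop) (i y t : M) : Prop :=
  ∃ r, E y r ∧ t < (y + 1) * (r + 1) + r ∧ t < (y + 1) * (r + 1) + i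

/-- The columns of the second half of the `i`-th order. They shrink with `i`. -/
def shrinking (E : M → M → Prop) (i y t : M) : Prop :=
  ∃ r, E y r ∧ (t = 0 ∨ t + i ≤ r)

/-- The columns of the `i`-th order. -/
def columns (E : M → M → Prop) (b i y t : M) : Prop :=
  (y < b ∧ growing E i y t) ∨ ∃ z, z < b ∧ y = b + z ∧ shrinking E i z t

theorem columns_of_lt {E : M → M → Prop} {b i y t : M} (hy : y < b) :
    columns E b i y t ↔ growing E i y t := by
  refine ⟨?_, fun h => .inl ⟨hy, h⟩⟩
  rintro (⟨-, h⟩ | ⟨z, -, rfl, -⟩)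
  · exact h
  · exact absurd hy (not_lt.2 le_self_add)

theorem columns_add {E : M → M → Prop} {b i z t : M} (hz : z < b) :
    columns E b i (b + z) t ↔ shrinking E i z t := by
  refine ⟨?_, fun h => .inr ⟨z, hz, rfl, h⟩⟩
  rintro (⟨h, -⟩ | ⟨z', -, e, h⟩)
  · exact absurd h (not_lt.2 le_self_add)
  · rwa [add_left_cancel e]

theorem columns_self {E : M → M → Prop} {b i t : M} (hb : 0 < b) :
    columns E b i b t ↔ shrinking E i 0 t := by
  simpa using columns_add (E := E) (i := i) (t := t) hb

theorem lt_of_columns {E : M → M → Prop} {b i y t : M} (h : columns E b i y t) : y < b + b := by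
  obtain ⟨hy, -⟩ | ⟨z, hz, rfl, -⟩ := h
  · exact hy.trans_le le_self_add
  · gcongr

namespace IsCutFamily

variable (h : ModelsRCA0 S) {b : M} {E : M → M → Prop} (hE : IsCutFamily S b E)
include h hE

omit hE in
theorem growing_zero (hE : IsCutFamily S b E) (i y : M) : growing E i y 0 := by
  refine ⟨0, hE.base y, ?_, ?_⟩ <;> simp

omit hE in
theorem shrinking_zero (hE : IsCutFamily S b E) (i y : M) : shrinking E i y 0 :=
  ⟨0, hE.base y, .inl rfl⟩

theorem growing_univ_iff {i y : M} : (∀ t, growing E i y t) ↔ ∀ r, E y r := by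
  constructor
  · intro hg r
    obtain ⟨s, hs, h₁, -⟩ := hg ((y + 1) * (r + 1) + r)
    refine hE.down hs (not_lt.1 fun hlt => not_le.2 h₁ ?_)
    gcongr
  · intro hg t
    have e : (y + 1) * (t + 1) = y * t + y + t + 1 := by ring
    refine ⟨t, hg t, ?_, ?_⟩ <;>
    grind [zero_lt_one (α := M), zero_le (a := y), zero_le (a := i), zero_le (a := t),
      zero_le (a := y * t)]

theorem shrinking_univ_iff {i y : M} : (∀ t, shrinking E i y t) ↔ ∀ r, E y r := by
  constructor
  · intro hg r
    obtain ⟨s, hs, h₁⟩ := hg (r + 1)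
    refine hE.down hs ?_
    rcases h₁ with h₁ | h₁
    · exact absurd h₁ (by grind [zero_lt_one (α := M), zero_le (a := r)])
    · grind [zero_lt_one (α := M), zero_le (a := i)]
  · exact fun hg t => ⟨t + i, hg _, .inr le_rfl⟩

theorem growing_down {i y s t : M} (ht : growing E i y t) (hs : s ≤ t) : growing E i y s := by
  obtain ⟨r, hr, h₁, h₂⟩ := ht
  exact ⟨r, hr, hs.trans_lt h₁, hs.trans_lt h₂⟩

theorem shrinking_down {i y s t : M} (ht : shrinking E i y t) (hs : s ≤ t) :
    shrinking E i y s := by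
  obtain ⟨r, hr, rfl | h₁⟩ := ht
  · exact ⟨r, hr, .inl (le_antisymm hs zero_le)⟩
  · exact ⟨r, hr, .inr (by grind)⟩

theorem columns_down {i y s t : M} (ht : columns E b i y t) (hs : s ≤ t) :
    columns E b i y s :=
  ht.imp (fun h₁ => ⟨h₁.1, growing_down h hE h₁.2 hs⟩)
    fun ⟨z, hz, e, h₁⟩ => ⟨z, hz, e, shrinking_down h hE h₁ hs⟩

theorem growing_mono {i j y t : M} (hij : i ≤ j) (ht : growing E i y t) : growing E j y t := by
  obtain ⟨r, hr, h₁, h₂⟩ := ht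
  exact ⟨r, hr, h₁, by grind⟩

/-- The purpose of the factor `y + 1`: the next column gains `r + 1`, more than the index can ever
add, so this holds for all `i` and `j`. -/
theorem growing_succ (i : M) {j y t : M} (ht : growing E j y t) : growing E i (y + 1) t := by
  obtain ⟨r, hr, h₁, h₂⟩ := ht
  have e : (y + 1 + 1) * (r + 1) = (y + 1) * (r + 1) + r + 1 := by ring
  refine ⟨r, hE.mono hr (lt_add_one y).le, ?_, ?_⟩ <;>
  grind [zero_lt_one (α := M), zero_le (a := r), zero_le (a := i)]

theorem shrinking_anti {i j y t : M} (hij : i ≤ j) (ht : shrinking E j y t) :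
    shrinking E i y t := by
  obtain ⟨r, hr, h₁⟩ := ht
  exact ⟨r, hr, h₁.imp id fun h₁ => by grind⟩

theorem lt_top {x s : M} (hx : ¬ E x s) : x < b :=
  not_le.1 fun hle => hx (hE.mono (hE.top s) hle)

/-- For `i` the smaller of two indices, the columns given by this `x` tell the two orders apart, in
either half. -/
theorem exists_greatest_bound (i : M) :
    ∃ x r, x < b ∧ i < r ∧ E x r ∧ ∀ s, E x s → s ≤ r := by
  obtain ⟨x, hx, s, hs⟩ := hE.unbounded (i + 1)
  obtain ⟨r, hr, hmax⟩ := h.exists_greatest (P := fun r => E x r)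
    (hE.sigma.subst (e := ![fun _ => x, fun v => v 0])
      (by intro i; fin_cases i; exacts [.const x, .var 0])) ⟨_, hx⟩
    (a := s) fun u hu => not_lt.1 fun hlt => hs (hE.down hu hlt.le)
  exact ⟨x, r, hE.lt_top h hs, h.add_one_le_iff.1 (hmax _ hx), hr, hmax⟩

theorem exists_shrinking {i j : M} (hij : i < j) :
    ∃ x t, x < b ∧ shrinking E i x t ∧ ¬ shrinking E j x t := by
  obtain ⟨x, r, hx, hir, hr, hmax⟩ := hE.exists_greatest_bound h i
  obtain ⟨t, rfl⟩ := exists_add_of_le hir.le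
  refine ⟨x, t, hx, ⟨i + t, hr, .inr (by grind)⟩, ?_⟩
  rintro ⟨s, hs, rfl | h₁⟩
  · simp at hir
  · grind [hmax s hs]

theorem exists_growing {i j : M} (hij : j < i) :
    ∃ x t, x < b ∧ growing E i x t ∧ ¬ growing E j x t := by
  obtain ⟨x, r, hx, hir, hr, hmax⟩ := hE.exists_greatest_bound h j
  refine ⟨x, (x + 1) * (r + 1) + j, hx, ⟨r, hr, by grind, by grind⟩, ?_⟩
  rintro ⟨s, hs, -, h₁⟩
  have := hmax s hs
  refine not_le.2 h₁ ?_
  gcongr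

theorem pos : ∃ a, b = a + 1 := by
  obtain rfl | hb := h.eq_zero_or_eq_add_one b
  · obtain ⟨r, hr⟩ := hE.zero
    exact (hr (hE.top r)).elim
  · exact hb

theorem not_columnMap_of_lt {i j : M} (hij : i < j) {G : M → M → M → M → Prop}
    (hG : IsColumnMap S (b + b) (columns E b i) (columns E b j) G) : False := by
  obtain ⟨a, ha⟩ := hE.pos h
  have hab : a < b := ha ▸ lt_add_one a
  have hb : 0 < b := zero_le.trans_lt hab
  obtain ⟨x, t, hx, h₁, h₂⟩ := hE.exists_shrinking h hij
  have split : ∀ {y}, a ≤ y → y < b + a → y = a ∨ ∃ z, z + 1 < b ∧ y = b + z := by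
    intro y hay hyb
    rcases hay.eq_or_lt with rfl | hay
    · exact .inl rfl
    · obtain ⟨z, rfl⟩ := exists_add_of_le (h.add_one_le_iff.2 hay)
      exact .inr ⟨z, by grind, by rw [ha]⟩
  have hcol : ∀ {y s}, a ≤ y → y < b + a → columns E b j (y + 1) s → columns E b i (y + 1) s := by
    intro y s hay hyb hc
    rcases split hay hyb with rfl | ⟨z, hz, rfl⟩
    · rw [← ha, columns_self hb] at hc ⊢
      exact shrinking_anti h hE hij.le hc
    · rw [add_assoc, columns_add hz] at *
      exact shrinking_anti h hE hij.le hc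
  -- The very last column has nowhere to move up to. At `y = a` the universality condition is
  -- vacuous, because the next column comes from `E 0`, which is bounded.
  have hle : ∀ {y s z' s'}, a ≤ y → y ≤ b + a → G y s z' s' → z' ≤ y := by
    refine hG.le_of_top h (T := b + a) (by gcongr) ?_ ?_ hcol ?_
    · intro s z' s' hg
      have := lt_of_columns (hG.cod hg)
      exact h.lt_add_one_iff.1 (by grind)
    · intro y hay hyb
      rcases split hay hyb with rfl | ⟨z, hz, rfl⟩
      · rw [← ha, columns_self hb]
        exact hE.shrinking_zero h _ _
      · rw [add_assoc, columns_add hz]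
        exact hE.shrinking_zero h _ _
    · intro y hay hyb hc
      rcases split hay hyb with rfl | ⟨z, hz, rfl⟩
      · simp only [← ha, columns_self hb] at hc
        rw [hE.shrinking_univ_iff h] at hc
        obtain ⟨r, hr⟩ := hE.zero
        exact (hr (hc r)).elim
      · simp only [add_assoc, columns_add hz, columns_add ((lt_add_one z).trans hz)] at *
        rw [hE.shrinking_univ_iff h] at *
        exact hE.pred hc
  have hxb : b + x < b + b := by gcongr
  have hxa : x ≤ a := h.lt_add_one_iff.1 (ha ▸ hx)
  -- Column `b + x` is too long for its place, so it moves down, and so do the columns from `b` up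
  -- to it.
  obtain ⟨y', t', hy', hg⟩ := hG.lt_of_lt h (w := b) (x := b + x) le_self_add
    (hG.lt_of_not_subset h (s₀ := t) hxb (fun hg => hle (hab.le.trans le_self_add)
      (by gcongr) hg) ((columns_add hx).2 h₁) (mt (columns_add hx).1 h₂))
    (by
      intro y hy hyx
      obtain ⟨z, rfl⟩ := exists_add_of_le hy
      rw [columns_add ((lt_of_add_lt_add_left hyx).trans hx)]
      exact hE.shrinking_zero h _ _)
    (by
      intro y s hy hyx hc
      obtain ⟨z, rfl⟩ := exists_add_of_le hy
      rw [columns_add ((lt_of_add_lt_add_left hyx).trans hx)] at *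
      exact shrinking_anti h hE hij.le hc)
  have hy'a : y' ≤ a := h.lt_add_one_iff.1 (ha ▸ hy')
  have hbd : ∀ {s z' s'}, G a s z' s' → z' < y' ∨ z' = y' ∧ s' < t' := fun hg' =>
    hG.mono hg' hg (.inl hab)
  -- Column `a` is all of `M` and is mapped below `(y', t')`; inside column `a` it would climb past
  -- `t'`.
  have hlt : ∀ {s z' s'}, G a s z' s' → z' < a := by
    intro s z' s' hg'
    by_contra! haz
    obtain ⟨rfl, rfl⟩ : z' = a ∧ y' = z' := by
      rcases hbd hg' with h₂ | ⟨h₂, -⟩ <;> constructor <;> grind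
    obtain ⟨s'', h₃, hg''⟩ := hG.advance h hg'
      (fun hg => (hbd hg).elim le_of_lt fun h => h.1.le) (s := t')
      ((columns_of_lt hab).2 ((hE.growing_univ_iff h).2 (hE.pred (ha ▸ hE.top)) _))
    rcases hbd hg'' with h₂ | ⟨-, h₂⟩
    · exact lt_irrefl _ h₂
    · grind [zero_le (a := s')]
  have hG' := hG.shift h (k := b) le_self_add
  obtain ⟨z, s, hg'⟩ := hG'.total hb (t := 0) ((columns_of_lt hb).2 (hE.growing_zero h _ _))
  -- With the targets renumbered upwards by one, column `a` still does not move up, hence neither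
  -- does column `0`; yet its new target has the form `z' + 1`.
  have := hG'.le_of_top h (w := 0) (T := a) hab
    (by
      rintro s _ s' ⟨-, z', rfl, hg⟩
      exact h.add_one_le_iff.2 (hlt hg))
    (by
      intro y _ hya
      rw [columns_of_lt (ha ▸ add_lt_add_left hya 1)]
      exact hE.growing_zero h _ _)
    (by
      rintro y s - hya ⟨z, hz, hc⟩
      obtain rfl := add_right_cancel hz
      rw [columns_of_lt (hya.trans hab)] at hc
      rw [columns_of_lt (ha ▸ add_lt_add_left hya 1)]
      exact growing_succ h hE i hc)
    (by
      intro y _ hya hc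
      have hc' : ∀ s, columns E b j y s := fun s => by
        obtain ⟨z, hz, hc⟩ := hc s
        rwa [add_right_cancel hz]
      simp only [columns_of_lt (hya.trans hab), hE.growing_univ_iff h] at *
      exact hc')
    le_rfl zero_le hg'
  obtain ⟨-, z', rfl, -⟩ := hg'
  exact absurd this (by grind [zero_lt_one (α := M), zero_le (a := z')])

/-- Otherwise take the last column `x ≥ a` that moves up, and write `x + 1 = b + z`. By `not_jump`,
`E z` is bounded. But column `a` is all of `M` and lies below the image of column `b + z`, so it
climbs without bound in some column `b + w` with `w ≤ z`. This makes `E w`, and therefore `E z`,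
unbounded. -/
theorem le_pred {a i j : M} (ha : b = a + 1) {G : M → M → M → M → Prop}
    (hG : IsColumnMap S (b + b) (columns E b i) (columns E b j) G) {s₀ z₀ s₀' : M}
    (hg₀ : G a s₀ z₀ s₀') : z₀ ≤ a := by
  by_contra! hz₀
  have hab : a < b := ha ▸ lt_add_one a
  have hb : 0 < b := zero_le.trans_lt hab
  have hEa : ∀ r, E a r := hE.pred (ha ▸ hE.top)
  have hCa : ∀ s, columns E b i a s := fun s =>
    (columns_of_lt hab).2 ((hE.growing_univ_iff h).2 hEa s)
  obtain ⟨x, ⟨hax, t, x', t', hg, hlt⟩, hmax⟩ := h.exists_greatest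
    (P := fun x => a ≤ x ∧ ∃ t x' t', G x t x' t' ∧ x < x')
    (.and (.bdd (.le (.const a) (.var 0)))
      (.ex (.ex (.ex (.and (hG.sigma.comp₄ (.var 3) (.var 2) (.var 1) (.var 0))
        (.bdd (.lt (.var 3) (.var 1))))))))
    ⟨a, le_rfl, s₀, z₀, s₀', hg₀, hz₀⟩ (a := b + b)
    (by rintro x ⟨-, t, x', t', hg, -⟩; exact (hG.dom hg).le)
  have hx : x + 1 < b + b := (h.add_one_le_iff.2 hlt).trans_lt (lt_of_columns (hG.cod hg))
  have hnext : ∀ {s z' s'}, G (x + 1) s z' s' → z' ≤ x + 1 := by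
    intro s z' s' hg'
    by_contra! hlt'
    exact absurd (hmax (x + 1) ⟨hax.trans (lt_add_one x).le, s, z', s', hg', hlt'⟩)
      (not_le.2 (lt_add_one x))
  obtain ⟨z, hz⟩ := exists_add_of_le (show b ≤ x + 1 by rw [ha]; gcongr)
  rw [hz] at hx hnext
  have hzb : z < b := lt_of_add_lt_add_left hx
  have h₀ : columns E b i (b + z) 0 := (columns_add hzb).2 (hE.shrinking_zero h i z)
  have hbdd : ¬ ∀ r, E z r := by
    intro hEz
    refine absurd (hG.not_jump h (x := x) (hz ▸ hx) (fun hg => ?_) (hz ▸ h₀) (fun _ => ?_)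
      (fun _ s => ?_) hg) (not_le.2 hlt)
    · rw [hz] at hg ⊢
      exact hnext hg
    · rw [hz, columns_add hzb]
      exact (hE.shrinking_univ_iff h).2 hEz _
    · rcases hax.eq_or_lt with rfl | hax
      · exact hCa s
      · obtain ⟨w, rfl⟩ := exists_add_of_le (h.add_one_le_iff.2 hax)
        rw [← ha] at hz hg hlt ⊢
        obtain rfl : w + 1 = z := by rw [add_assoc] at hz; exact add_left_cancel hz
        rw [columns_add ((lt_add_one w).trans hzb)]
        exact (hE.shrinking_univ_iff h).2 (hE.pred hEz) s
  obtain ⟨u, u', hu⟩ := hG.total hx h₀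
  have huz := hnext hu
  have hbd : ∀ {s z' s'}, G a s z' s' → z' ≤ u := fun hg' =>
    (hG.mono hg' hu (.inl (hab.trans_le le_self_add))).elim le_of_lt fun h => h.1.le
  obtain ⟨y, ⟨s, s', hy⟩, hmax⟩ := h.exists_greatest (P := fun y => ∃ s s', G a s y s')
    (.ex (.ex (hG.sigma.comp₄ (.const a) (.var 1) (.var 2) (.var 0)))) ⟨z₀, s₀, s₀', hg₀⟩
    (a := u) fun y ⟨s, s', hy⟩ => hbd hy
  obtain ⟨w, rfl⟩ := exists_add_of_le (show b ≤ y by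
    rw [ha]; exact h.add_one_le_iff.2 (hz₀.trans_le (hmax _ ⟨_, _, hg₀⟩)))
  have hwz : w ≤ z := le_of_add_le_add_left ((hbd hy).trans huz)
  refine hbdd fun r => hE.mono ((hE.shrinking_univ_iff h (i := j)).1 (fun t => ?_) r) hwz
  obtain ⟨t', ht', hg'⟩ := hG.advance h hy (fun hg => hmax _ ⟨_, _, hg⟩) (s := t) (hCa _)
  rw [← columns_add (hwz.trans_lt hzb)]
  exact hG.down' (hG.cod hg') (le_add_self.trans ht')

theorem not_columnMap_of_gt {i j : M} (hij : j < i) {G : M → M → M → M → Prop}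
    (hG : IsColumnMap S (b + b) (columns E b i) (columns E b j) G) : False := by
  obtain ⟨a, ha⟩ := hE.pos h
  have hab : a < b := ha ▸ lt_add_one a
  obtain ⟨x, t, hx, h₁, h₂⟩ := hE.exists_growing h hij
  have hsub : ∀ {y s}, y < b → columns E b j y s → columns E b i y s := by
    intro y s hy hc
    rw [columns_of_lt hy] at *
    exact growing_mono h hE hij.le hc
  have hlt : ∀ {y}, y < a → y + 1 < b := fun hy => ha ▸ add_lt_add_left hy 1
  have hxa : x ≤ a := h.lt_add_one_iff.1 (ha ▸ hx)
  obtain ⟨y', t', hy', -⟩ := hG.lt_of_lt h (w := 0) (x := x) zero_le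
    (hG.lt_of_not_subset h (s₀ := t) (hx.trans_le le_self_add)
      (fun hg => hG.le_of_top h (w := 0) (T := a) (hab.trans_le le_self_add)
        (fun hg => hE.le_pred h ha hG hg)
        (fun _ hy => (columns_of_lt (hlt hy)).2 (hE.growing_zero h _ _))
        (fun _ hy => hsub (hlt hy))
        (fun _ hy hc => by
          simp only [columns_of_lt (hlt hy), columns_of_lt (hy.trans hab)] at *
          rw [hE.growing_univ_iff h] at *
          exact hE.pred hc) zero_le hxa hg)
      ((columns_of_lt hx).2 h₁) (mt (columns_of_lt hx).1 h₂))
    (fun _ hy => (columns_of_lt (hy.trans hx)).2 (hE.growing_zero h _ _))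
    (fun _ hy => hsub (hy.trans hx))
  exact h.not_lt_zero _ hy'

end IsCutFamily
end Antichain

/-! ### Coding the orders by sets, and the failing induction as a cut. -/

section Coding

variable {M : Type*} [CommSemiring M] [LinearOrder M] [IsStrictOrderedRing M]
  [CanonicallyOrderedAdd M] {S : Set (Set M)}

theorem IsBdd.comp₄ {Q : M → M → M → M → Prop}
    (hQ : IsBdd S 4 fun v => Q (v 0) (v 1) (v 2) (v 3)) {n : ℕ} {f g k l : (Fin n → M) → M}
    (hf : IsTerm n f) (hg : IsTerm n g) (hk : IsTerm n k) (hl : IsTerm n l) :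
    IsBdd S n fun v => Q (f v) (g v) (k v) (l v) :=
  hQ.subst (e := ![f, g, k, l]) (by intro i; fin_cases i <;> assumption)

theorem left_le_pair (m n : M) : m ≤ pair m n := le_add_self

theorem ModelsRCA0.right_le_pair (h : ModelsRCA0 S) (m n : M) : n ≤ pair m n := by
  have hn : n ≤ n * n := by
    obtain rfl | ⟨k, rfl⟩ := h.eq_zero_or_eq_add_one n
    · simp
    · exact le_mul_of_one_le_left zero_le le_add_self
  calc n ≤ n * n := hn
    _ ≤ (m + n) * (m + n) := by gcongr <;> exact le_add_self
    _ ≤ pair m n := le_self_add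

theorem ModelsRCA0.pair_inj (h : ModelsRCA0 S) {m n m' n' : M} (e : pair m n = pair m' n') :
    m = m' ∧ n = n' := by
  have key : ∀ {m n m' n' : M}, m + n < m' + n' → pair m n < pair m' n' := by
    intro m n m' n' hlt
    have h₁ := h.add_one_le_iff.2 hlt
    calc pair m n ≤ (m + n) * (m + n) + (m + n) := by unfold pair; gcongr; exact le_self_add
      _ < (m + n) * (m + n) + (m + n) + ((m + n) + 1) :=
        lt_add_of_pos_right _ (zero_le.trans_lt (lt_add_one _))
      _ = (m + n + 1) * (m + n + 1) := by ring
      _ ≤ (m' + n') * (m' + n') := by gcongr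
      _ ≤ pair m' n' := le_self_add
  have hs : m + n = m' + n' := by
    rcases _root_.lt_trichotomy (m + n) (m' + n') with hlt | hs | hlt
    · exact absurd e (key hlt).ne
    · exact hs
    · exact absurd e (key hlt).ne'
  have hm : m = m' := by
    unfold pair at e
    rw [hs] at e
    exact add_left_cancel e
  subst hm
  exact ⟨rfl, add_left_cancel hs⟩

theorem ModelsRCA0.triple_inj (h : ModelsRCA0 S) {y t w y' t' w' : M}
    (e : pair (pair y t) w = pair (pair y' t') w') : y = y' ∧ t = t' ∧ w = w' := by
  obtain ⟨e₁, rfl⟩ := h.pair_inj e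
  obtain ⟨rfl, rfl⟩ := h.pair_inj e₁
  exact ⟨rfl, rfl, rfl⟩

/-- The members of the sequence of orders that is coded by `Z` consist of the triples `(y, t, w)`
with `W i y t w`, ordered lexicographically by `(y, t)`. -/
def IsLexCode (Z : Set M) (W : M → M → M → M → Prop) : Prop :=
  ∀ i e e', le (nth Z i) e e' ↔ ∃ y t w y' t' w', e = pair (pair y t) w ∧
    e' = pair (pair y' t') w' ∧ W i y t w ∧ W i y' t' w' ∧ (y < y' ∨ y = y' ∧ t ≤ t')

theorem ModelsRCA0.exists_isLexCode (h : ModelsRCA0 S) {W : M → M → M → M → Prop}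
    (hW : IsBdd S 4 fun v => W (v 0) (v 1) (v 2) (v 3)) : ∃ Z ∈ S, IsLexCode Z W := by
  obtain ⟨Z, hZ, hmem⟩ := h.exists_mem_iff (P := fun c => ∃ i, i < c + 1 ∧
    ∃ y, y < c + 1 ∧ ∃ t, t < c + 1 ∧ ∃ w, w < c + 1 ∧
    ∃ y', y' < c + 1 ∧ ∃ t', t' < c + 1 ∧ ∃ w', w' < c + 1 ∧
    c = pair (pair (pair (pair y t) w) (pair (pair y' t') w')) i ∧ W i y t w ∧ W i y' t' w' ∧
    (y < y' ∨ y = y' ∧ t ≤ t')) (by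
      repeat' first
        | apply hW.comp₄
        | apply IsBdd.le
        | apply IsTerm.pair
        | constructor)
  refine ⟨Z, hZ, fun i e e' => ?_⟩
  refine (hmem _).trans ⟨?_, ?_⟩
  · rintro ⟨i', -, y, -, t, -, w, -, y', -, t', -, w', -, he, h₁, h₂, h₃⟩
    obtain ⟨he₁, rfl⟩ := h.pair_inj he
    obtain ⟨rfl, rfl⟩ := h.pair_inj he₁
    exact ⟨y, t, w, y', t', w', rfl, rfl, h₁, h₂, h₃⟩
  · rintro ⟨y, t, w, y', t', w', rfl, rfl, h₁, h₂, h₃⟩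
    have l₁ := left_le_pair (pair (pair (pair y t) w) (pair (pair y' t') w')) i
    have l₂ := (left_le_pair (pair (pair y t) w) (pair (pair y' t') w')).trans l₁
    have l₃ := (h.right_le_pair (pair (pair y t) w) (pair (pair y' t') w')).trans l₁
    have l₄ := (left_le_pair (pair y t) w).trans l₂
    have l₅ := (left_le_pair (pair y' t') w').trans l₃
    simp only [h.lt_add_one_iff]
    exact ⟨i, h.right_le_pair _ _, y, (left_le_pair _ _).trans l₄, t,
      (h.right_le_pair _ _).trans l₄, w, (h.right_le_pair _ _).trans l₂, y',
      (left_le_pair _ _).trans l₅, t', (h.right_le_pair _ _).trans l₅, w',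
      (h.right_le_pair _ _).trans l₃, rfl, h₁, h₂, h₃⟩

namespace IsLexCode

variable (h : ModelsRCA0 S) {Z : Set M} {W : M → M → M → M → Prop} (hZ : IsLexCode Z W)
include h hZ

theorem le_triple_iff {i y t w y' t' w' : M} :
    le (nth Z i) (pair (pair y t) w) (pair (pair y' t') w') ↔
      W i y t w ∧ W i y' t' w' ∧ (y < y' ∨ y = y' ∧ t ≤ t') := by
  rw [hZ]
  constructor
  · rintro ⟨y, t, w, y', t', w', e, e', h₁⟩
    obtain ⟨rfl, rfl, rfl⟩ := h.triple_inj e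
    obtain ⟨rfl, rfl, rfl⟩ := h.triple_inj e'
    exact h₁
  · exact fun h₁ => ⟨_, _, _, _, _, _, rfl, rfl, h₁⟩

theorem mem_field_iff {i e : M} :
    e ∈ field (nth Z i) ↔ ∃ y t w, e = pair (pair y t) w ∧ W i y t w := by
  constructor
  · intro he
    obtain ⟨y, t, w, -, -, -, he, -, h₁, -⟩ := (hZ _ _ _).1 he
    exact ⟨y, t, w, he, h₁⟩
  · rintro ⟨y, t, w, rfl, h₁⟩
    exact (hZ.le_triple_iff h).2 ⟨h₁, h₁, .inr ⟨rfl, le_rfl⟩⟩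

variable (hW : ∀ {i y t w w'}, W i y t w → W i y t w' → w = w')
include hW

theorem lt_triple_iff {i y t w y' t' w' : M} :
    lt (nth Z i) (pair (pair y t) w) (pair (pair y' t') w') ↔
      W i y t w ∧ W i y' t' w' ∧ (y < y' ∨ y = y' ∧ t < t') := by
  rw [lt, hZ.le_triple_iff h]
  constructor
  · rintro ⟨⟨h₁, h₂, h₃⟩, hne⟩
    refine ⟨h₁, h₂, h₃.imp id ?_⟩
    rintro ⟨rfl, hle⟩
    refine ⟨rfl, lt_of_le_of_ne hle ?_⟩
    rintro rfl
    exact hne (by rw [hW h₁ h₂])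
  · rintro ⟨h₁, h₂, h₃⟩
    refine ⟨⟨h₁, h₂, h₃.imp id fun h₃ => ⟨h₃.1, h₃.2.le⟩⟩, fun e => ?_⟩
    obtain ⟨rfl, rfl, -⟩ := h.triple_inj e
    simp at h₃

theorem isLinOrder (i : M) : IsLinOrder (nth Z i) where
  refl a b hab := by
    obtain ⟨y, t, w, y', t', w', rfl, rfl, h₁, h₂, -⟩ := (hZ _ _ _).1 hab
    exact ⟨(hZ.mem_field_iff h).2 ⟨_, _, _, rfl, h₁⟩, (hZ.mem_field_iff h).2 ⟨_, _, _, rfl, h₂⟩⟩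
  antisymm a b hab hba := by
    obtain ⟨y, t, w, y', t', w', rfl, rfl, h₁, h₂, h₃⟩ := (hZ _ _ _).1 hab
    obtain ⟨-, -, h₄⟩ := (hZ.le_triple_iff h).1 hba
    obtain ⟨rfl, rfl⟩ : y = y' ∧ t = t' := by constructor <;> grind
    rw [hW h₁ h₂]
  trans a b c hab hbc := by
    obtain ⟨y, t, w, y', t', w', rfl, rfl, h₁, h₂, h₃⟩ := (hZ _ _ _).1 hab
    obtain ⟨y₁, t₁, w₁, y₂, t₂, w₂, e, rfl, -, h₅, h₆⟩ := (hZ _ _ _).1 hbc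
    obtain ⟨rfl, rfl, rfl⟩ := h.triple_inj e
    exact (hZ.le_triple_iff h).2 ⟨h₁, h₅, by grind⟩
  total a ha b hb := by
    obtain ⟨y, t, w, rfl, h₁⟩ := (hZ.mem_field_iff h).1 ha
    obtain ⟨y', t', w', rfl, h₂⟩ := (hZ.mem_field_iff h).1 hb
    simp only [hZ.le_triple_iff h, h₁, h₂, true_and]
    grind

/-- Among the values of a descending sequence there is a least column and in it a least place, both
by `Σ⁰₁` minimization; the next value contradicts one of the two choices. -/
theorem isWellOrder (i : M) : IsWellOrder S (nth Z i) := by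
  refine ⟨hZ.isLinOrder h hW i, ?_⟩
  rintro ⟨F, hF, ⟨hdom, hfun⟩, hdesc⟩
  have hval : ∀ n, ∃ y t w, W i y t w ∧ pair n (pair (pair y t) w) ∈ F := by
    intro n
    obtain ⟨a, hna, -⟩ := hfun n (Set.mem_univ n)
    obtain ⟨_, -, _, ha, e⟩ := hdom _ hna
    obtain ⟨rfl, rfl⟩ := h.pair_inj e
    obtain ⟨y, t, w, rfl, h₁⟩ := (hZ.mem_field_iff h).1 ha
    exact ⟨y, t, w, h₁, hna⟩
  obtain ⟨y₁, t₁, w₁, -, h₁⟩ := hval 0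
  obtain ⟨y, ⟨n₂, t₂, w₂, h₂⟩, hy⟩ := h.exists_least
    (P := fun y => ∃ n t w, pair n (pair (pair y t) w) ∈ F)
    (.ex (.ex (.ex (.bdd (.mem hF
      (.pair (.var 2) (.pair (.pair (.var 3) (.var 1)) (.var 0))))))))
    ⟨y₁, 0, t₁, w₁, h₁⟩
  obtain ⟨t, ⟨n, w, h₃⟩, ht⟩ := h.exists_least
    (P := fun t => ∃ n w, pair n (pair (pair y t) w) ∈ F)
    (.ex (.ex (.bdd (.mem hF
      (.pair (.var 1) (.pair (.pair (.const y) (.var 2)) (.var 0)))))))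
    ⟨t₂, n₂, w₂, h₂⟩
  obtain ⟨y', t', w', -, h₄⟩ := hval (n + 1)
  obtain ⟨-, -, h₅⟩ := (hZ.lt_triple_iff h hW).1 (hdesc n _ _ h₃ h₄)
  rcases h₅ with h₅ | ⟨rfl, h₅⟩
  · exact absurd (hy y' ⟨_, _, _, h₄⟩) (not_le.2 h₅)
  · exact absurd (ht t' ⟨_, _, h₄⟩) (not_le.2 h₅)

/-- Projecting the third components away leaves a `Σ⁰₁` graph, which is all that `IsColumnMap` asks
for. -/
theorem exists_columnMap (hWb : IsBdd S 4 fun v => W (v 0) (v 1) (v 2) (v 3))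
    {C : M → M → M → Prop} (hC : ∀ {i y t}, C i y t ↔ ∃ w, W i y t w)
    (hdown : ∀ {i y s t}, C i y t → s ≤ t → C i y s) {m : M} (hm : ∀ {i y t}, C i y t → y < m)
    {i j : M} (hij : Embeds S (nth Z i) (nth Z j)) :
    ∃ G, IsColumnMap S m (C i) (C j) G := by
  obtain ⟨F, hF, ⟨hdom, hfun⟩, hmono⟩ := hij
  have hcod : ∀ {y t w y' t' w'}, pair (pair (pair y t) w) (pair (pair y' t') w') ∈ F →
      W j y' t' w' := by
    intro y t w y' t' w' hp
    obtain ⟨a, -, b, hb, e⟩ := hdom _ hp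
    obtain ⟨-, rfl⟩ := h.pair_inj e
    obtain ⟨y₁, t₁, w₁, e, h₁⟩ := (hZ.mem_field_iff h).1 hb
    obtain ⟨rfl, rfl, rfl⟩ := h.triple_inj e
    exact h₁
  refine ⟨fun y t y' t' => ∃ w w', W i y t w ∧
    pair (pair (pair y t) w) (pair (pair y' t') w') ∈ F, ?_, hdown, hdown, ?_, ?_, ?_, ?_⟩
  · exact .ex (.ex (.bdd (.and (hWb.comp₄ (.const i) (.var 2) (.var 3) (.var 1)) (.mem hF
      (.pair (.pair (.pair (.var 2) (.var 3)) (.var 1))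
        (.pair (.pair (.var 4) (.var 5)) (.var 0)))))))
  · intro y t _ hc
    obtain ⟨w, hw⟩ := hC.1 hc
    obtain ⟨b, hab, -⟩ := hfun _ ((hZ.mem_field_iff h).2 ⟨y, t, w, rfl, hw⟩)
    obtain ⟨_, -, _, hb, e⟩ := hdom _ hab
    obtain ⟨-, rfl⟩ := h.pair_inj e
    obtain ⟨y', t', w', rfl, -⟩ := (hZ.mem_field_iff h).1 hb
    exact ⟨y', t', w, w', hw, hab⟩
  · rintro y t y' t' ⟨w, w', hw, -⟩
    exact hm (hC.2 ⟨w, hw⟩)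
  · rintro y t y' t' ⟨w, w', -, hp⟩
    exact hC.2 ⟨w', hcod hp⟩
  · rintro y t y' t' z s z' s' ⟨w, w', hw, hp⟩ ⟨x, x', hx, hq⟩ hlt
    exact ((hZ.lt_triple_iff h hW).1
      (hmono _ _ _ _ hp hq ((hZ.lt_triple_iff h hW).2 ⟨hw, hx, hlt⟩))).2.2

end IsLexCode

/-- `w` bounds witnesses for `columns E b i y t`, where `E x r` is `∃ v, E₀ x r v`. -/
def columnBound (E₀ : M → M → M → Prop) (b i y t w : M) : Prop :=
  (y < b ∧ ∃ r, r < w + 1 ∧ ∃ v, v < w + 1 ∧ E₀ y r v ∧ t < (y + 1) * (r + 1) + r ∧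
    t < (y + 1) * (r + 1) + i) ∨
  ∃ z, z < b ∧ y = b + z ∧ ∃ r, r < w + 1 ∧ ∃ v, v < w + 1 ∧ E₀ z r v ∧ (t = 0 ∨ t + i ≤ r)

theorem ModelsRCA0.columns_iff (h : ModelsRCA0 S) {E₀ : M → M → M → Prop} {b i y t : M} :
    columns (fun x r => ∃ v, E₀ x r v) b i y t ↔ ∃ w, columnBound E₀ b i y t w := by
  have l₁ : ∀ r v : M, r < r + v + 1 := fun r v => h.lt_add_one_iff.2 le_self_add
  have l₂ : ∀ r v : M, v < r + v + 1 := fun r v => h.lt_add_one_iff.2 le_add_self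
  constructor
  · rintro (⟨hy, r, ⟨v, hv⟩, h₁⟩ | ⟨z, hz, e, r, ⟨v, hv⟩, h₁⟩)
    · exact ⟨r + v, .inl ⟨hy, r, l₁ r v, v, l₂ r v, hv, h₁⟩⟩
    · exact ⟨r + v, .inr ⟨z, hz, e, r, l₁ r v, v, l₂ r v, hv, h₁⟩⟩
  · rintro ⟨w, ⟨hy, r, -, v, -, hv, h₁⟩ | ⟨z, hz, e, r, -, v, -, hv, h₁⟩⟩
    · exact .inl ⟨hy, r, ⟨v, hv⟩, h₁⟩
    · exact .inr ⟨z, hz, e, r, ⟨v, hv⟩, h₁⟩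

/-- `w` is the least bound for witnesses for `columns E b i y t`. -/
def leastColumnBound (E₀ : M → M → M → Prop) (b i y t w : M) : Prop :=
  columnBound E₀ b i y t w ∧ ∀ u, u < w → ¬ columnBound E₀ b i y t u

theorem IsBdd.columnBound {E₀ : M → M → M → Prop}
    (hE : IsBdd S 3 fun v => E₀ (v 0) (v 1) (v 2)) (b : M) {n : ℕ}
    {f g k l : (Fin n → M) → M} (hf : IsTerm n f) (hg : IsTerm n g) (hk : IsTerm n k)
    (hl : IsTerm n l) : IsBdd S n fun v => columnBound E₀ b (f v) (g v) (k v) (l v) := by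
  have : IsBdd S 4 fun v => SecondOrderArithmetic.columnBound E₀ b (v 0) (v 1) (v 2) (v 3) := by
    unfold SecondOrderArithmetic.columnBound
    repeat' first
      | apply hE.comp₃
      | apply IsBdd.le
      | constructor
  exact this.comp₄ hf hg hk hl

/-- The columns are only `Σ⁰₁`, so comprehension does not apply to them. Attaching the least witness
bound to each point makes the field bounded-definable, and its uniqueness keeps the order unchanged.
-/
theorem IsCutFamily.not_WF2 (h : ModelsRCA0 S) {E₀ : M → M → M → Prop} {b : M}
    (hE₀ : IsBdd S 3 fun v => E₀ (v 0) (v 1) (v 2))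
    (hE : IsCutFamily S b fun x r => ∃ v, E₀ x r v) : ¬ WF2 S := by
  intro hWF
  have hWb : IsBdd S 4 fun v => leastColumnBound E₀ b (v 0) (v 1) (v 2) (v 3) :=
    .and (hE₀.columnBound b (.var 0) (.var 1) (.var 2) (.var 3))
      (.ball (.var 3) (.not (hE₀.columnBound b (.var 1) (.var 2) (.var 3) (.var 0))))
  have hW : ∀ {i y t w w'}, leastColumnBound E₀ b i y t w → leastColumnBound E₀ b i y t w' →
      w = w' := fun h₁ h₂ =>
    le_antisymm (not_lt.1 fun hlt => h₁.2 _ hlt h₂.1) (not_lt.1 fun hlt => h₂.2 _ hlt h₁.1)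
  obtain ⟨Z, hZS, hZ⟩ := h.exists_isLexCode hWb
  obtain ⟨i, j, hij, hemb⟩ := hWF Z hZS fun i => hZ.isWellOrder h hW i
  have hC : ∀ {i y t}, columns (fun x r => ∃ v, E₀ x r v) b i y t ↔
      ∃ w, leastColumnBound E₀ b i y t w := by
    intro i y t
    rw [h.columns_iff]
    constructor
    · intro hw
      obtain ⟨w, hw, hmin⟩ := h.exists_least (P := fun w => columnBound E₀ b i y t w)
        (.bdd (hE₀.columnBound b (.const i) (.const y) (.const t) (.var 0))) hw
      exact ⟨w, hw, fun u hu hc => absurd (hmin u hc) (not_le.2 hu)⟩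
    · exact fun ⟨w, hw⟩ => ⟨w, hw.1⟩
  obtain ⟨G, hG⟩ := hZ.exists_columnMap h hW hWb hC (hE.columns_down h) lt_of_columns hemb
  rcases lt_or_gt_of_ne hij with hlt | hlt
  · exact hE.not_columnMap_of_lt h hlt hG
  · exact hE.not_columnMap_of_gt h hlt hG

theorem isCutFamily_of_progressive (h : ModelsRCA0 S) {T : M → M → M → Prop}
    (hT : IsBdd S 3 fun v => T (v 0) (v 1) (v 2)) (h₀ : ∃ u, ∀ v, T v u 0)
    (hs : ∀ x, (∃ u, ∀ v, T v u x) → ∃ u, ∀ v, T v u (x + 1)) {b : M}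
    (hb : ¬ ∃ u, ∀ v, T v u b) :
    IsCutFamily S b fun x r => ∃ v, ∃ y, y < x + 1 ∧ ∀ u, u < r → ∃ v', v' < v ∧ ¬ T v' u y := by
  -- Collection supplies the common bound `v` for the counterexamples to all `u < r`.
  have key : ∀ {x r}, (¬ ∃ v, ∃ y, y < x + 1 ∧ ∀ u, u < r → ∃ v', v' < v ∧ ¬ T v' u y) →
      ∀ y, y < x + 1 → ∃ u, u < r ∧ ∀ v, T v u y := by
    intro x r hxr y hy
    by_contra! hc
    exact hxr ((h.collection (Q := fun u v => ¬ T v u y)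
      (.not (hT.comp₃ (.var 1) (.var 0) (.const y))) hc).imp fun w hw => ⟨y, hy, hw⟩)
  -- If witnesses below `r` exist up to `x`, then a witness `u₁` at `x + 1` gives the bound `r + u₁
  -- + 1` up to `x + 1`.
  have hpred : ∀ {x}, (∀ r, ∃ v, ∃ y, y < x + 1 + 1 ∧ ∀ u, u < r → ∃ v', v' < v ∧ ¬ T v' u y) →
      ∀ r, ∃ v, ∃ y, y < x + 1 ∧ ∀ u, u < r → ∃ v', v' < v ∧ ¬ T v' u y := by
    intro x hx r
    by_contra hr
    have hr' := key hr
    obtain ⟨u₀, -, hu₀⟩ := hr' x (lt_add_one x)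
    obtain ⟨u₁, hu₁⟩ := hs x ⟨u₀, hu₀⟩
    obtain ⟨v, y, hy, hv⟩ := hx (r + u₁ + 1)
    obtain ⟨u, hu, hyu⟩ : ∃ u, u < r + u₁ + 1 ∧ ∀ v, T v u y := by
      rcases (h.lt_succ_iff _ _).1 hy with hy | rfl
      · obtain ⟨u, hu, hyu⟩ := hr' y hy
        exact ⟨u, h.lt_add_one_iff.2 (hu.le.trans le_self_add), hyu⟩
      · exact ⟨u₁, h.lt_add_one_iff.2 le_add_self, hu₁⟩
    obtain ⟨v', -, hv'⟩ := hv u hu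
    exact hv' (hyu v')
  have hsigma : IsSigma S 2 fun w => ∃ v, ∃ y, y < w 0 + 1 ∧
      ∀ u, u < w 1 → ∃ v', v' < v ∧ ¬ T v' u y := by
    refine .ex (.bdd ?_)
    repeat' first
      | apply hT.comp₃
      | constructor
  have hzero : ∃ r, ¬ ∃ v, ∃ y, y < (0 : M) + 1 ∧ ∀ u, u < r → ∃ v', v' < v ∧ ¬ T v' u y := by
    obtain ⟨u, hu⟩ := h₀
    refine ⟨u + 1, ?_⟩
    rintro ⟨v, y, hy, hv⟩
    obtain rfl : y = 0 := le_antisymm (h.lt_add_one_iff.1 hy) zero_le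
    obtain ⟨v', -, hv'⟩ := hv u (lt_add_one u)
    exact hv' (hu v')
  have htop : ∀ r, ∃ v, ∃ y, y < b + 1 ∧ ∀ u, u < r → ∃ v', v' < v ∧ ¬ T v' u y := by
    intro r
    by_contra hr
    obtain ⟨u, -, hu⟩ := key hr b (lt_add_one b)
    exact hb ⟨u, hu⟩
  refine ⟨hsigma, ?_, ?_, hpred, htop, ?_, hzero, ?_⟩
  · rintro x r s ⟨v, y, hy, hv⟩ hrs
    exact ⟨v, y, hy, fun u hu => hv u (hu.trans_le hrs)⟩
  · rintro x y r ⟨v, z, hz, hv⟩ hxy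
    exact ⟨v, z, hz.trans_le (by gcongr), hv⟩
  · exact fun x => ⟨0, x, lt_add_one x, fun u hu => (h.not_lt_zero u hu).elim⟩
  · intro r
    by_contra! hc
    -- If no bounded segment contained `r`, the segment at the least such `x` would be unbounded,
    -- and by `hpred` so would its predecessor.
    obtain ⟨x, hx, hmin⟩ := h.exists_least (P := fun x => ∃ v, ∃ y, y < x + 1 ∧
      ∀ u, u < r → ∃ v', v' < v ∧ ¬ T v' u y)
      (hsigma.subst (e := ![fun v => v 0, fun _ => r])
        (by intro i; fin_cases i; exacts [.var 0, .const r])) ⟨b, htop r⟩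
    obtain rfl | ⟨z, rfl⟩ := h.eq_zero_or_eq_add_one x
    · obtain ⟨s, hs⟩ := hzero
      exact hs (hc 0 hx s)
    · exact absurd (hmin z (hpred (hc _ hx) r)) (not_le.2 (lt_add_one z))

theorem ModelsRCA0.sigma02Induction (h : ModelsRCA0 S) (hWF : WF2 S) : Sigma02Induction S := by
  rintro P ⟨k, n, θ, X, p, hX, hP⟩ h₀ hs b
  by_contra hb
  simp only [hP] at h₀ hs hb
  have hT : IsBdd S 3 fun w : Fin 3 → M =>
      θ.Sat X (Fin.cons (w 0) (Fin.cons (w 1) (Fin.cons (w 2) p))) := by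
    have := IsBdd.sat θ hX (n := 3) (e := Fin.cons (fun w => w 0) (Fin.cons (fun w => w 1)
      (Fin.cons (fun w => w 2) fun i _ => p i)))
      (Fin.cases (.var 0) (Fin.cases (.var 1) (Fin.cases (.var 2) fun i => .const (p i))))
    refine this.congr fun w => ?_
    have e : (Fin.cons (w 0) (Fin.cons (w 1) (Fin.cons (w 2) p)) : Fin (n + 3) → M) = fun i =>
        (Fin.cons (fun w => w 0) (Fin.cons (fun w => w 1) (Fin.cons (fun w => w 2)
          fun i _ => p i)) : Fin (n + 3) → (Fin 3 → M) → M) i w := by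
      funext i
      refine Fin.cases rfl (Fin.cases rfl (Fin.cases rfl fun i => rfl)) i
    rw [e]
  refine IsCutFamily.not_WF2 h ?_ (isCutFamily_of_progressive h
    (T := fun v u x => θ.Sat X (Fin.cons v (Fin.cons u (Fin.cons x p)))) hT h₀ hs hb) hWF
  repeat' first
    | apply IsBdd.comp₃ (Q := fun v u x => θ.Sat X (Fin.cons v (Fin.cons u (Fin.cons x p)))) hT
    | constructor

end Coding

end SecondOrderArithmetic

theorem mainTheorem6 {M : Type*} [Zero M] [One M] [Add M] [Mul M] [LT M] (S : Set (Set M))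
    (hRCA : SecondOrderArithmetic.ModelsRCA0 S) (hWF : SecondOrderArithmetic.WF2 S) :
    SecondOrderArithmetic.Sigma02Induction S := by
  let _ := hRCA.commSemiring
  let _ := hRCA.linearOrder
  have := hRCA.isStrictOrderedRing
  have := hRCA.canonicallyOrderedAdd
  exact SecondOrderArithmetic.ModelsRCA0.sigma02Induction hRCA hWF
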